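/- Let $A$ be a simplicial line arrangement, i.e. a finite set of lines in the real projective plane such that every cell of $A$ (every connected component of the complement of the union of the lines) is a projective triangle. Regard the points of the projective plane as the lines through the origin of $\mathbb{R}^3$, and let $\hat A$ be the finite set of planes through the origin of $\mathbb{R}^3$ that contains, for each line $\ell\in A$, the plane formed by the lines through the origin that are the points of $\ell$. (In the affine chart $z=1$ this is the plane through $\ell$ and the origin; the line at infinity gives the plane $z=0$.) Let $C_A$ be the graph with one vertex for each cell of $\hat A$ (each connected component of the complement in $\mathbb{R}^3$ of the union of the planes), in which two different cells are adjacent if and only if they meet along a two-dimensional face of $\hat A$ (a connected component of the complement, in one plane of $\hat A$, of the union of the other planes). Then $C_A$ is a planar graph. More precisely, let the planes of $\hat A$ intersect the unit sphere $S^2$ in an arrangement of great circles. The crossing points of these great circles, as vertices, and the open arcs into which the crossing points divide the great circles, as edges, form a finite graph embedded in $S^2$, and $C_A$ is the planar dual of this embedded graph: $C\mapsto C\cap S^2$ is a bijection from the vertices of $C_A$ onto the faces of the embedded graph; there is a bijection from the edges of $C_A$ onto the arcs such that the two faces incident with an arc are those corresponding to the two ends of the edge; and $C_A$ can be drawn on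 $S^2$ without crossings, with each vertex in its face and with each edge meeting the embedded graph in exactly one point, which lies on the arc corresponding to that edge. -/

import Mathlib

open scoped LinearAlgebra.Projectivization

noncomputable section

/-! ### Cells and facets of an arrangement in a topological space -/

section Arrangement

variable {X : Type*} [TopologicalSpace X]

/-- The (top-dimensional) cells of a family `𝓗` of subsets of `X` (lines in the projective plane,
planes in space, great circles on the sphere): the connected components of the complement of the
union of the family. -/
def arrangementCells (𝓗 : Set (Set X)) : Set (Set X) :=
  {C | ∃ x ∈ (⋃₀ 𝓗)ᶜ, C = connectedComponentIn (⋃₀ 𝓗)ᶜ x}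

/-- The faces of codimension one: the connected components of what remains of one member `H` of
the family when all the other members are removed. -/
def arrangementFacets (𝓗 : Set (Set X)) : Set (Set X) :=
  {F | ∃ H ∈ 𝓗, ∃ x ∈ H \ ⋃₀ (𝓗 \ {H}), F = connectedComponentIn (H \ ⋃₀ (𝓗 \ {H})) x}

/-- The points that lie on at least two different members of the family. -/
def arrangementCrossings (𝓗 : Set (Set X)) : Set X :=
  {x | ∃ H ∈ 𝓗, ∃ K ∈ 𝓗, H ≠ K ∧ x ∈ H ∧ x ∈ K}

/-- The graph with one vertex for each top-dimensional cell, in which two different cells are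
adjacent when they meet along a face of codimension one. -/
def cellGraph (𝓗 : Set (Set X)) : SimpleGraph (arrangementCells 𝓗) where
  Adj C D := C ≠ D ∧
    ∃ F ∈ arrangementFacets 𝓗, F ⊆ closure (C : Set X) ∧ F ⊆ closure (D : Set X)
  symm := ⟨fun _ _ h => ⟨h.1.symm, h.2.imp fun _ hF => ⟨hF.1, hF.2.2, hF.2.1⟩⟩⟩
  loopless := ⟨fun _ h => h.1 rfl⟩

end Arrangement

/-! ### Lines in the real projective plane and simplicial arrangements -/

/-- Euclidean three-space. -/
abbrev E3 : Type := EuclideanSpace ℝ (Fin 3)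

/-- The real projective plane `ℙ ℝ E3` carries the quotient topology from `E3 ∖ {0}`. -/
instance projectivePlaneTopology : TopologicalSpace (ℙ ℝ E3) :=
  inferInstanceAs (TopologicalSpace (Quotient (projectivizationSetoid ℝ E3)))

/-- A line in the projective plane: a projective subspace of projective dimension one. -/
def IsProjectiveLine (ℓ : Projectivization.Subspace ℝ E3) : Prop :=
  Module.finrank ℝ (Projectivization.Subspace.submodule ℓ) = 2

/-- An open triangle in the projective plane. Its corners are the points `[b 0]`, `[b 1]`, `[b 2]`,
which are not collinear, and its points are the `[v]` with `v` a positive combination of the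
`b i`. The triangles with given corners (there are four of them) correspond to the choices of signs
of the `b i`. -/
def IsProjectiveTriangle (T : Set (ℙ ℝ E3)) : Prop :=
  ∃ b : Module.Basis (Fin 3) ℝ E3,
    T = {p | ∃ (v : E3) (hv : v ≠ 0), (∀ i, 0 < b.repr v i) ∧ p = Projectivization.mk ℝ v hv}

/-- The point sets of the lines of an arrangement. -/
def lineSets (A : Finset (Projectivization.Subspace ℝ E3)) : Set (Set (ℙ ℝ E3)) :=
  {L | ∃ ℓ ∈ A, L = (ℓ : Set (ℙ ℝ E3))}

/-- A simplicial line arrangement: a finite set of lines in the real projective plane all of whose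
cells are triangles. -/
structure IsSimplicialLineArrangement (A : Finset (Projectivization.Subspace ℝ E3)) : Prop where
  isLine : ∀ ℓ ∈ A, IsProjectiveLine ℓ
  isTriangle : ∀ T ∈ arrangementCells (lineSets A), IsProjectiveTriangle T

/-! ### The lifted arrangements and the graph `C_A` -/

/-- The lifted arrangement in `E3`: for each line of `A`, the plane through the origin that consists
of `0` and of the vectors representing the points of the line. (In the affine chart `z = 1` this is
the plane spanned by the line and the origin; the line at infinity gives the plane `z = 0`.) -/
def liftedPlanes (A : Finset (Projectivization.Subspace ℝ E3)) : Set (Set E3) :=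
  {H | ∃ ℓ ∈ A, H = (Projectivization.Subspace.submodule ℓ : Set E3)}

/-- The graph `C_A`: the graph of cells of the lifted arrangement of planes. -/
def arrangementGraph (A : Finset (Projectivization.Subspace ℝ E3)) :
    SimpleGraph (arrangementCells (liftedPlanes A)) :=
  cellGraph (liftedPlanes A)

/-- The unit sphere in `E3`. -/
abbrev UnitSphere : Type := Metric.sphere (0 : E3) 1

/-- The intersection of a subset of `E3` with the unit sphere. -/
def onSphere (S : Set E3) : Set UnitSphere := Subtype.val ⁻¹' S

/-- The arrangement of great circles in which the lifted planes meet the unit sphere. -/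
def greatCircles (A : Finset (Projectivization.Subspace ℝ E3)) : Set (Set UnitSphere) :=
  onSphere '' liftedPlanes A

/-! ### Embedded graphs, planarity and planar duality -/

section Planarity

variable {X : Type*} [TopologicalSpace X]

/-- `a` is the interior of a simple arc in `X` with end points `p` and `q`. -/
def IsOpenArc (a : Set X) (p q : X) : Prop :=
  ∃ γ : unitInterval → X, Continuous γ ∧ Function.Injective γ ∧ γ 0 = p ∧ γ 1 = q ∧
    a = γ '' Set.Ioo 0 1

/-- A drawing without crossings of the graph `G` in the space `X`. -/
structure GraphDrawing {V : Type*} (G : SimpleGraph V) (X : Type*) [TopologicalSpace X] where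
  /-- the point that represents a vertex -/
  pos : V → X
  /-- the open arc that represents an edge -/
  arc : G.edgeSet → Set X
  pos_injective : Function.Injective pos
  isOpenArc : ∀ (u v : V) (h : G.Adj u v),
    IsOpenArc (arc ⟨s(u, v), G.mem_edgeSet.2 h⟩) (pos u) (pos v)
  pos_notMem_arc : ∀ (v : V) (e : G.edgeSet), pos v ∉ arc e
  arc_disjoint : ∀ e f : G.edgeSet, e ≠ f → Disjoint (arc e) (arc f)

/-- A graph is planar if it can be drawn without crossings in the Euclidean plane. -/
def IsPlanarGraph {V : Type*} (G : SimpleGraph V) : Prop :=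
  Nonempty (GraphDrawing G (EuclideanSpace ℝ (Fin 2)))

/-- The finite point set `P` and the finite set `𝓔` of open arcs form a (loopless multi)graph
embedded in `X`. -/
structure IsEmbeddedGraph (P : Set X) (𝓔 : Set (Set X)) : Prop where
  finite_vertices : P.Finite
  finite_edges : 𝓔.Finite
  isOpenArc : ∀ a ∈ 𝓔, ∃ p ∈ P, ∃ q ∈ P, IsOpenArc a p q
  vertex_notMem_edge : ∀ p ∈ P, ∀ a ∈ 𝓔, p ∉ a
  edge_disjoint : ∀ a ∈ 𝓔, ∀ b ∈ 𝓔, a ≠ b → Disjoint a b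

/-- The faces of an embedded graph: the connected components of the complement of its vertices and
edges. -/
def embeddedFaces (P : Set X) (𝓔 : Set (Set X)) : Set (Set X) :=
  {R | ∃ x ∈ (P ∪ ⋃₀ 𝓔)ᶜ, R = connectedComponentIn (P ∪ ⋃₀ 𝓔)ᶜ x}

/-- The graph `G` is the dual of the embedded graph `(P, 𝓔)`, where the vertex `v` of `G`
corresponds to the face `φ v`, and where the edge `e` of `G` corresponds to the edge `ψ e`:
both correspondences are one-to-one, the faces incident with `ψ e` are those of the two ends of `e`,
and `G` can be drawn in `X` with each vertex in its face and with each edge `e` crossing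
the embedded graph in exactly one point, which lies on `ψ e`. -/
def IsPlanarDual {V : Type*} (G : SimpleGraph V) (P : Set X) (𝓔 : Set (Set X))
    (φ : V → Set X) : Prop :=
  Function.Injective φ ∧ Set.range φ = embeddedFaces P 𝓔 ∧
  ∃ ψ : G.edgeSet ≃ 𝓔,
    (∀ (u v : V) (h : G.Adj u v), ∀ R ∈ embeddedFaces P 𝓔,
      (ψ ⟨s(u, v), G.mem_edgeSet.2 h⟩ : Set X) ⊆ closure R ↔ R = φ u ∨ R = φ v) ∧
    ∃ D : GraphDrawing G X,
      (∀ v, D.pos v ∈ φ v) ∧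
      ∀ e, ∃ x ∈ (ψ e : Set X), D.arc e ∩ (P ∪ ⋃₀ 𝓔) = {x}

end Planarity

end

/-! Choose for each line a linear form whose kernel is the lifted plane. The set where all forms
have prescribed strict signs is convex, and by the intermediate value theorem no connected set
avoiding the planes changes a sign; so cells are sign regions, and facets are sign regions inside
one plane. Radial projection carries this description to the sphere, where the same inequalities
define the faces and arcs of the great circles.

Duality then becomes bookkeeping with signs. A facet in the plane of `f i` lies in the closure of a
cell exactly when the signs of all other forms agree. So exactly two cells touch it, one on each
side, and conversely two cells that share a facet determine it (`eq_or_eq_of_incident`,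
`facet_unique`, `exists_incident_pair`). This gives the bijection between edges and arcs.

For the drawing, take a point `c v` in each cell and a point `x e` on each arc, and join `c u` to `x
e` to `c v` by great circle segments. Each segment stays in its open cell until it reaches `x e`,
and segments from one `c v` to different boundary points do not meet (`eq_of_mem_halfArc_inter`). A
crossing of two circles is therefore missed by the drawing, and stereographic projection from it
gives a drawing in the plane.

That the cells are triangles matters only for having at least two lines: otherwise the complement
contains an affine plane, which fits into no triangle (`IsSimplicialLineArrangement.nontrivial`).
Two lines suffice for crossings to exist and for every facet on the sphere to be an arc ending at
crossings. -/

noncomputable section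

/-! ### Arrangements of zero sets of continuous functions -/

section ZeroSets

variable {X ι : Type*}

/-- The family of the zero sets of the functions `g i`. -/
def zeroSets (g : ι → X → ℝ) : Set (Set X) := Set.range fun i => {x | g i x = 0}

/-- The points at which each `g i` has the sign that it has at `x`. -/
def signCell (g : ι → X → ℝ) (x : X) : Set X := {y | ∀ i, 0 < g i x * g i y}

/-- The zeros of `g i` at which each other `g j` has the sign that it has at `x`. -/
def signFacet (g : ι → X → ℝ) (i : ι) (x : X) : Set X :=
  {y | g i y = 0 ∧ ∀ j, j ≠ i → 0 < g j x * g j y}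

/-- The function `g i` vanishes at `x`, and no other `g j` does. -/
def IsFacetPoint (g : ι → X → ℝ) (i : ι) (x : X) : Prop := g i x = 0 ∧ ∀ j, j ≠ i → g j x ≠ 0

/-- The sets `signCell g x` with `x` a common non-zero. -/
def signCells (g : ι → X → ℝ) : Set (Set X) := {C | ∃ x, (∀ i, g i x ≠ 0) ∧ C = signCell g x}

/-- The sets `signFacet g i x` with `x` a zero of `g i` only. -/
def signFacets (g : ι → X → ℝ) : Set (Set X) :=
  {F | ∃ i x, IsFacetPoint g i x ∧ F = signFacet g i x}

/-- The points at which at least two of the `g i` vanish. -/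
def multipleZeros (g : ι → X → ℝ) : Set X := {x | ∃ i j, i ≠ j ∧ g i x = 0 ∧ g j x = 0}

/-- A positive product encodes "same nonzero sign", and this is the transitivity of that relation.
-/
theorem mul_pos_trans {a b c : ℝ} (hab : 0 < a * b) (hbc : 0 < b * c) : 0 < a * c := by
  have hb : 0 < b * b := mul_self_pos.2 (right_ne_zero_of_mul hab.ne')
  have : 0 < (b * b) * (a * c) := by
    have := mul_pos hab hbc
    linarith [show a * b * (b * c) = b * b * (a * c) by ring]
  exact pos_of_mul_pos_right this hb.le

theorem mul_pos_symm {a b : ℝ} (hab : 0 < a * b) : 0 < b * a := by rwa [mul_comm]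

/-- On a connected set without zeros of `g j` the sign of `g j` is constant, so a component cannot
leave the sign region; preconnectedness of the region gives the other inclusion. Cells are the case
of full `K` and `J`; facets take for `K` the zeros of `g i` and for `J` the other indices. -/
theorem connectedComponentIn_eq_of_signs [TopologicalSpace X] {g : ι → X → ℝ} (hg : ∀ i, Continuous (g i))
    {K : Set X} {J : Set ι} {x : X} (hx : x ∈ K) (hne : ∀ j ∈ J, g j x ≠ 0)
    (hpre : IsPreconnected {y | y ∈ K ∧ ∀ j ∈ J, 0 < g j x * g j y}) :
    connectedComponentIn {y | y ∈ K ∧ ∀ j ∈ J, g j y ≠ 0} x =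
      {y | y ∈ K ∧ ∀ j ∈ J, 0 < g j x * g j y} := by
  apply Set.Subset.antisymm
  · intro y hy
    have hsub := connectedComponentIn_subset {y | y ∈ K ∧ ∀ j ∈ J, g j y ≠ 0} x
    refine ⟨(hsub hy).1, fun j hj => ?_⟩
    by_contra hneg
    have hxmem : x ∈ connectedComponentIn {y | y ∈ K ∧ ∀ j ∈ J, g j y ≠ 0} x :=
      mem_connectedComponentIn ⟨hx, hne⟩
    obtain ⟨z, hz, hz0⟩ := isPreconnected_connectedComponentIn.intermediate_value hy hxmem
      (f := fun z => g j x * g j z) ((hg j).const_mul (g j x)).continuousOn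
      ⟨not_lt.1 hneg, mul_self_nonneg _⟩
    exact mul_ne_zero (hne j hj) ((hsub hz).2 j hj) hz0
  · exact hpre.subset_connectedComponentIn ⟨hx, fun j hj => mul_self_pos.2 (hne j hj)⟩
      fun y hy => ⟨hy.1, fun j hj => right_ne_zero_of_mul (hy.2 j hj).ne'⟩

theorem compl_sUnion_zeroSets (g : ι → X → ℝ) : (⋃₀ zeroSets g)ᶜ = {y | ∀ i, g i y ≠ 0} := by
  ext y; simp [zeroSets]

theorem sdiff_sUnion_zeroSets {g : ι → X → ℝ}
    (hinj : Function.Injective fun i => {x | g i x = 0}) (i : ι) :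
    {x | g i x = 0} \ ⋃₀ (zeroSets g \ {{x | g i x = 0}}) = {y | IsFacetPoint g i y} := by
  ext y
  constructor
  · rintro ⟨h0, h⟩
    exact ⟨h0, fun j hj hy => h ⟨_, ⟨⟨j, rfl⟩, fun h' => hj (hinj h')⟩, hy⟩⟩
  · rintro ⟨h0, h⟩
    refine ⟨h0, ?_⟩
    rintro ⟨_, ⟨⟨j, rfl⟩, hne⟩, hy⟩
    exact h j (fun hj => hne (by subst hj; rfl)) hy

theorem arrangementCells_zeroSets [TopologicalSpace X] {g : ι → X → ℝ} (hg : ∀ i, Continuous (g i))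
    (hpre : ∀ x, IsPreconnected (signCell g x)) :
    arrangementCells (zeroSets g) = signCells g := by
  have key : ∀ x, (∀ i, g i x ≠ 0) →
      connectedComponentIn {y | ∀ i, g i y ≠ 0} x = signCell g x := fun x hx => by
    have := connectedComponentIn_eq_of_signs hg (K := Set.univ) (J := Set.univ) (Set.mem_univ x)
      (fun j _ => hx j) (by simpa [signCell] using hpre x)
    simpa [signCell] using this
  ext C
  simp only [arrangementCells, signCells, compl_sUnion_zeroSets, Set.mem_ofPred_eq]
  constructor <;> rintro ⟨x, hx, rfl⟩
  · exact ⟨x, hx, key x hx⟩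
  · exact ⟨x, hx, (key x hx).symm⟩

theorem arrangementFacets_zeroSets [TopologicalSpace X] {g : ι → X → ℝ} (hg : ∀ i, Continuous (g i))
    (hinj : Function.Injective fun i => {x | g i x = 0})
    (hpre : ∀ i x, IsPreconnected (signFacet g i x)) :
    arrangementFacets (zeroSets g) = signFacets g := by
  have key : ∀ i x, IsFacetPoint g i x →
      connectedComponentIn {y | IsFacetPoint g i y} x = signFacet g i x := fun i x hx =>
    connectedComponentIn_eq_of_signs hg (K := {y | g i y = 0}) (J := {j | j ≠ i}) hx.1 hx.2
      (hpre i x)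
  ext F
  constructor
  · rintro ⟨_, ⟨i, rfl⟩, x, hx, rfl⟩
    rw [sdiff_sUnion_zeroSets hinj] at hx ⊢
    exact ⟨i, x, hx, key i x hx⟩
  · rintro ⟨i, x, hx, rfl⟩
    refine ⟨_, ⟨i, rfl⟩, x, ?_⟩
    rw [sdiff_sUnion_zeroSets hinj]
    exact ⟨hx, (key i x hx).symm⟩

theorem arrangementCrossings_zeroSets {g : ι → X → ℝ}
    (hinj : Function.Injective fun i => {x | g i x = 0}) :
    arrangementCrossings (zeroSets g) = multipleZeros g := by
  ext x
  constructor
  · rintro ⟨_, ⟨i, rfl⟩, _, ⟨j, rfl⟩, hne, hi, hj⟩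
    exact ⟨i, j, fun h => hne (by subst h; rfl), hi, hj⟩
  · rintro ⟨i, j, hne, hi, hj⟩
    exact ⟨_, ⟨i, rfl⟩, _, ⟨j, rfl⟩, fun h => hne (hinj h), hi, hj⟩

theorem mem_signCell_self {g : ι → X → ℝ} {x : X} (hx : ∀ i, g i x ≠ 0) : x ∈ signCell g x :=
  fun i => mul_self_pos.2 (hx i)

theorem mem_signFacet_self {g : ι → X → ℝ} {i : ι} {x : X} (hx : IsFacetPoint g i x) :
    x ∈ signFacet g i x :=
  ⟨hx.1, fun j hj => mul_self_pos.2 (hx.2 j hj)⟩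

theorem signCell_eq_of_mem {g : ι → X → ℝ} {x y : X} (h : y ∈ signCell g x) :
    signCell g y = signCell g x := by
  ext z
  exact ⟨fun hz i => mul_pos_trans (h i) (hz i),
    fun hz i => mul_pos_trans (mul_pos_symm (h i)) (hz i)⟩

theorem IsFacetPoint.of_mem {g : ι → X → ℝ} {i : ι} {x y : X} (h : y ∈ signFacet g i x) :
    IsFacetPoint g i y :=
  ⟨h.1, fun j hj => right_ne_zero_of_mul (h.2 j hj).ne'⟩

theorem signFacet_eq_of_mem {g : ι → X → ℝ} {i : ι} {x y : X} (h : y ∈ signFacet g i x) :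
    signFacet g i y = signFacet g i x := by
  ext z
  exact ⟨fun hz => ⟨hz.1, fun j hj => mul_pos_trans (h.2 j hj) (hz.2 j hj)⟩,
    fun hz => ⟨hz.1, fun j hj => mul_pos_trans (mul_pos_symm (h.2 j hj)) (hz.2 j hj)⟩⟩

theorem IsFacetPoint.index_eq {g : ι → X → ℝ} {i j : ι} {x : X} (hi : IsFacetPoint g i x)
    (hj : IsFacetPoint g j x) : i = j := by
  by_contra h
  exact hj.2 i h hi.1

theorem signFacet_eq_of_inter {g : ι → X → ℝ} {i j : ι} {x y z : X} (hx : z ∈ signFacet g i x)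
    (hy : z ∈ signFacet g j y) : signFacet g i x = signFacet g j y := by
  obtain rfl := (IsFacetPoint.of_mem hx).index_eq (IsFacetPoint.of_mem hy)
  rw [← signFacet_eq_of_mem hx, ← signFacet_eq_of_mem hy]

/-- Vertices and edges together fill the union of the circles, so the faces of the embedded graph
are the cells of the circle arrangement. -/
theorem sUnion_facets_union_crossings (g : ι → X → ℝ) :
    multipleZeros g ∪
      ⋃₀ signFacets g = {x | ∃ i, g i x = 0} := by
  ext y
  constructor
  · rintro (⟨i, j, -, hi, -⟩ | ⟨_, ⟨i, x, -, rfl⟩, hy⟩)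
    · exact ⟨i, hi⟩
    · exact ⟨i, hy.1⟩
  · rintro ⟨i, hi⟩
    by_cases h : ∃ j, i ≠ j ∧ g j y = 0
    · obtain ⟨j, hij, hj⟩ := h
      exact Or.inl ⟨i, j, hij, hi, hj⟩
    · push Not at h
      have hf : IsFacetPoint g i y := ⟨hi, fun j hj => h j hj.symm⟩
      exact Or.inr ⟨_, ⟨i, y, hf, rfl⟩, mem_signFacet_self hf⟩

theorem finite_signFacets [Finite ι] (g : ι → X → ℝ) :
    (signFacets g).Finite := by
  classical
  refine (Set.finite_range fun p : ι × (ι → SignType) =>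
    {y | g p.1 y = 0 ∧ ∀ j, j ≠ p.1 → SignType.sign (g j y) = p.2 j ∧ g j y ≠ 0}).subset ?_
  rintro _ ⟨i, x, hx, rfl⟩
  refine ⟨(i, fun j => SignType.sign (g j x)), ?_⟩
  ext y
  refine and_congr_right fun _ => forall_congr' fun j => forall_congr' fun hj => ?_
  rcases lt_or_gt_of_ne (hx.2 j hj) with h | h
  · simp only [sign_neg h, sign_eq_neg_one_iff, ← smul_eq_mul, smul_pos_iff_of_neg_left h]
    exact ⟨fun h' => h'.1, fun h' => ⟨h', h'.ne⟩⟩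
  · simp only [sign_pos h, sign_eq_one_iff, mul_pos_iff_of_pos_left h]
    exact ⟨fun h' => h'.1, fun h' => ⟨h', h'.ne'⟩⟩

/-- The closures of the cells are described by weak inequalities. -/
def HasClosedCells [TopologicalSpace X] (g : ι → X → ℝ) : Prop :=
  ∀ c y, (∀ i, g i c ≠ 0) → (y ∈ closure (signCell g c) ↔ ∀ i, 0 ≤ g i c * g i y)

/-- The sign of `g i` at `c` is left free, which is why a facet borders cells on both sides. For the
other forms, the weak inequality at `x` is strict because they do not vanish there. -/
theorem signFacet_subset_closure_iff [TopologicalSpace X] {g : ι → X → ℝ} (hcl : HasClosedCells g) {i : ι} {x c : X}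
    (hx : IsFacetPoint g i x) (hc : ∀ i, g i c ≠ 0) :
    signFacet g i x ⊆ closure (signCell g c) ↔ ∀ j, j ≠ i → 0 < g j x * g j c := by
  constructor
  · intro h j hj
    have := (hcl c x hc).1 (h (mem_signFacet_self hx)) j
    exact mul_pos_symm (lt_of_le_of_ne this (mul_ne_zero (hc j) (hx.2 j hj)).symm)
  · intro h y hy
    refine (hcl c y hc).2 fun j => ?_
    by_cases hj : j = i
    · rw [hj, hy.1, mul_zero]
    · exact (mul_pos_trans (mul_pos_symm (h j hj)) (hy.2 j hj)).le

end ZeroSets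

/-! ### Arrangements of planes through the origin and of great circles -/

section LinearArrangement

variable {ι : Type*} (f : ι → E3 →ₗ[ℝ] ℝ)

/-- The linear forms of an arrangement of planes, as functions on space. -/
def planeFun (i : ι) (x : E3) : ℝ := f i x

/-- The linear forms of an arrangement of planes, as functions on the unit sphere. -/
def sphereFun (i : ι) (x : UnitSphere) : ℝ := f i x

theorem continuous_planeFun (i : ι) : Continuous (planeFun f i) :=
  (f i).continuous_of_finiteDimensional

theorem continuous_sphereFun (i : ι) : Continuous (sphereFun f i) :=
  (continuous_planeFun f i).comp continuous_subtype_val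

/-- The radial projection of a nonzero vector to the unit sphere. -/
def radial (v : E3) (hv : v ≠ 0) : UnitSphere :=
  ⟨‖v‖⁻¹ • v, by simp [norm_smul, hv]⟩

theorem continuous_radial {Y : Type*} [TopologicalSpace Y] {p : Y → E3} (hp : Continuous p)
    (h0 : ∀ y, p y ≠ 0) : Continuous fun y => radial (p y) (h0 y) :=
  ((hp.norm.inv₀ fun y => norm_ne_zero_iff.2 (h0 y)).smul hp).subtype_mk _

theorem radial_coe (x : UnitSphere) (hx : (x : E3) ≠ 0) : radial x hx = x :=
  Subtype.ext (by simp [radial])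

theorem unitSphere_ne_zero (x : UnitSphere) : (x : E3) ≠ 0 := by
  rw [← norm_ne_zero_iff, norm_eq_of_mem_sphere]
  exact one_ne_zero

theorem sphereFun_radial (i : ι) (v : E3) (hv : v ≠ 0) :
    sphereFun f i (radial v hv) = ‖v‖⁻¹ * planeFun f i v := by
  simp [sphereFun, radial, planeFun]

variable {f}

theorem mul_sphereFun_radial_pos_iff {i : ι} {v : E3} {hv : v ≠ 0} {a : ℝ} :
    0 < a * sphereFun f i (radial v hv) ↔ 0 < a * planeFun f i v := by
  rw [sphereFun_radial, mul_left_comm]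
  exact mul_pos_iff_of_pos_left (inv_pos.2 (norm_pos_iff.2 hv))

theorem sphereFun_radial_eq_zero_iff {i : ι} {v : E3} {hv : v ≠ 0} :
    sphereFun f i (radial v hv) = 0 ↔ planeFun f i v = 0 := by
  simp [sphereFun_radial, hv]

theorem radial_mem_signCell_iff {c : UnitSphere} {v : E3} {hv : v ≠ 0} :
    radial v hv ∈ signCell (sphereFun f) c ↔ v ∈ signCell (planeFun f) c :=
  forall_congr' fun _ => mul_sphereFun_radial_pos_iff

theorem isFacetPoint_radial_iff {i : ι} {v : E3} {hv : v ≠ 0} :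
    IsFacetPoint (sphereFun f) i (radial v hv) ↔ IsFacetPoint (planeFun f) i v :=
  and_congr sphereFun_radial_eq_zero_iff
    (forall_congr' fun _ => imp_congr Iff.rfl (not_congr sphereFun_radial_eq_zero_iff))

theorem signCell_radial (c : E3) (hc : c ≠ 0) :
    signCell (planeFun f) (radial c hc) = signCell (planeFun f) c := by
  ext y
  refine forall_congr' fun i => ?_
  rw [mul_comm, mul_comm (planeFun f i c)]
  exact mul_sphereFun_radial_pos_iff

theorem convex_signCell (x : E3) : Convex ℝ (signCell (planeFun f) x) := by
  have : signCell (planeFun f) x = ⋂ i, {y | 0 < (planeFun f i x • f i) y} := by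
    ext y; simp [signCell, planeFun]
  rw [this]
  exact convex_iInter fun i => convex_halfSpace_gt (planeFun f i x • f i).isLinear 0

theorem convex_signFacet (i : ι) (x : E3) : Convex ℝ (signFacet (planeFun f) i x) := by
  have : signFacet (planeFun f) i x =
      {y | f i y = 0} ∩ ⋂ j, ⋂ (_ : j ≠ i), {y | 0 < (planeFun f j x • f j) y} := by
    ext y; simp [signFacet, planeFun]
  rw [this]
  exact (convex_hyperplane (f i).isLinear 0).inter <| convex_iInter fun j =>
    convex_iInter fun _ => convex_halfSpace_gt (planeFun f j x • f j).isLinear 0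

/-- The trace on the sphere of a cone without `0` is the continuous radial image of the cone. -/
theorem isPreconnected_preimage_sphere {S : Set E3} (hS : IsPreconnected S) (h0 : (0 : E3) ∉ S)
    (hcone : ∀ v ∈ S, ∀ t : ℝ, 0 < t → t • v ∈ S) :
    IsPreconnected ((↑) ⁻¹' S : Set UnitSphere) := by
  have hne : ∀ v : S, (v : E3) ≠ 0 := fun v h => h0 (h ▸ v.2)
  have : ((↑) ⁻¹' S : Set UnitSphere) = Set.range fun v : S => radial v (hne v) := by
    ext y
    constructor
    · exact fun hy => ⟨⟨y, hy⟩, radial_coe y _⟩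
    · rintro ⟨v, rfl⟩
      exact hcone v v.2 _ (inv_pos.2 (norm_pos_iff.2 (hne v)))
  rw [this]
  have := isPreconnected_iff_preconnectedSpace.1 hS
  exact isPreconnected_range (continuous_radial continuous_subtype_val hne)

theorem isPreconnected_signCell_sphere [Nonempty ι] (x : UnitSphere) :
    IsPreconnected (signCell (sphereFun f) x) := by
  refine isPreconnected_preimage_sphere (convex_signCell (f := f) (x : E3)).isPreconnected
    (fun h => ?_) fun v hv t ht i => ?_
  · simpa [planeFun] using h (Classical.arbitrary ι)
  · have := mul_pos ht (hv i)
    simp only [planeFun, map_smul, smul_eq_mul] at this ⊢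
    rwa [mul_left_comm]

theorem isPreconnected_signFacet_sphere [Nontrivial ι] (i : ι) (x : UnitSphere) :
    IsPreconnected (signFacet (sphereFun f) i x) := by
  refine isPreconnected_preimage_sphere (convex_signFacet (f := f) i (x : E3)).isPreconnected
    (fun h => ?_) fun v hv t ht => ⟨?_, fun j hj => ?_⟩
  · obtain ⟨j, hj⟩ := exists_ne i
    simpa [planeFun] using h.2 j hj
  · have := hv.1
    simp only [planeFun, map_smul, smul_eq_mul] at this ⊢
    rw [this, mul_zero]
  · have := mul_pos ht (hv.2 j hj)
    simp only [planeFun, map_smul, smul_eq_mul] at this ⊢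
    rwa [mul_left_comm]

/-- Adding a positive multiple of an interior point turns all weak inequalities into strict ones.
This yields the closures of cells and also keeps the drawn segments inside them. -/
theorem add_smul_mem_signCell {c y : E3} (hc : ∀ i, planeFun f i c ≠ 0)
    (hy : ∀ i, 0 ≤ planeFun f i c * planeFun f i y) {s t : ℝ} (hs : 0 ≤ s) (ht : 0 < t) :
    s • y + t • c ∈ signCell (planeFun f) c := fun i => by
  have h1 := mul_pos ht (mul_self_pos.2 (hc i))
  have h2 := mul_nonneg hs (hy i)
  simp only [planeFun, map_add, map_smul, smul_eq_mul] at h1 h2 ⊢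
  linarith [mul_left_comm t (f i c) (f i c), mul_left_comm s (f i c) (f i y),
    mul_add (f i c) (s * f i y) (t * f i c)]

theorem hasClosedCells_of_tendsto {X : Type*} [TopologicalSpace X] {g : ι → X → ℝ}
    (hg : ∀ i, Continuous (g i))
    (h : ∀ c y, (∀ i, g i c ≠ 0) → (∀ i, 0 ≤ g i c * g i y) → y ∈ closure (signCell g c)) :
    HasClosedCells g := fun c y hc => by
  refine ⟨fun hy i => ?_, h c y hc⟩
  exact closure_minimal (s := signCell g c) (t := {z | 0 ≤ g i c * g i z})
    (fun z hz => (hz i).le) (isClosed_le continuous_const ((hg i).const_mul _)) hy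

theorem hasClosedCells_planeFun : HasClosedCells (planeFun f) := by
  refine hasClosedCells_of_tendsto (continuous_planeFun f) fun c y hc hy => ?_
  have hlim : Filter.Tendsto (fun t : ℝ => (1 : ℝ) • y + t • c) (nhdsWithin 0 (Set.Ioi 0))
      (nhds y) := by
    refine Filter.Tendsto.mono_left ?_ nhdsWithin_le_nhds
    have : Continuous fun t : ℝ => (1 : ℝ) • y + t • c := by fun_prop
    simpa using this.tendsto 0
  exact mem_closure_of_tendsto hlim
    (eventually_nhdsWithin_of_forall fun t ht => add_smul_mem_signCell hc hy zero_le_one ht)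

theorem zero_notMem_signCell [Nonempty ι] {c : E3} :
    (0 : E3) ∉ signCell (planeFun f) c := fun h => by
  simpa [planeFun] using h (Classical.arbitrary ι)

theorem hasClosedCells_sphereFun [Nonempty ι] : HasClosedCells (sphereFun f) := by
  refine hasClosedCells_of_tendsto (continuous_sphereFun f) fun c y hc hy => ?_
  have hmem : ∀ t : ℝ, 0 < t → (1 : ℝ) • (y : E3) + t • (c : E3) ∈ signCell (planeFun f) c :=
    fun t ht => add_smul_mem_signCell hc hy zero_le_one ht
  -- Radial projection needs nonzero vectors, so the path towards `c` is restricted to `t ≥ 0`: it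
  -- is `y` at `0` and lies in the cell afterwards.
  have hne : ∀ t : Set.Ici (0 : ℝ), (1 : ℝ) • (y : E3) + (t : ℝ) • (c : E3) ≠ 0 := by
    rintro ⟨t, ht⟩ h0
    rcases (Set.mem_Ici.1 ht).eq_or_lt with rfl | ht
    · exact unitSphere_ne_zero y (by simpa using h0)
    · exact zero_notMem_signCell (h0 ▸ hmem t ht)
  have hcont : Continuous fun t : Set.Ici (0 : ℝ) =>
      radial ((1 : ℝ) • (y : E3) + (t : ℝ) • (c : E3)) (hne t) :=
    continuous_radial (by fun_prop) hne
  have h0 : (⟨0, Set.mem_Ici.2 le_rfl⟩ : Set.Ici (0 : ℝ)) ∈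
      closure {t : Set.Ici (0 : ℝ) | 0 < (t : ℝ)} := by
    rw [closure_subtype]
    have : ((↑) '' {t : Set.Ici (0 : ℝ) | 0 < (t : ℝ)} : Set ℝ) = Set.Ioi 0 := by
      ext s
      constructor
      · rintro ⟨t, ht, rfl⟩; exact ht
      · exact fun hs => ⟨⟨s, Set.Ioi_subset_Ici_self hs⟩, hs, rfl⟩
    rw [this, closure_Ioi]
    exact Set.self_mem_Ici
  have := map_mem_closure hcont h0 (t := signCell (sphereFun f) c)
    fun t ht => radial_mem_signCell_iff.2 (hmem t ht)
  convert this using 1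
  exact Subtype.ext (by simp [radial])

end LinearArrangement

/-! ### The facets on the sphere are arcs -/

section FacetArcs

open Real

variable {ι : Type*} {f : ι → E3 →ₗ[ℝ] ℝ}

theorem exists_cos_sin_eq {a b : ℝ} (h : a ^ 2 + b ^ 2 = 1) :
    ∃ θ ∈ Set.Ioc (-π) π, a = cos θ ∧ b = sin θ := by
  have hn : ‖(⟨a, b⟩ : ℂ)‖ = 1 := by
    rw [← sq_eq_sq₀ (norm_nonneg _) zero_le_one, ← Complex.normSq_eq_norm_sq, Complex.normSq_apply]
    simpa [sq] using h
  have h0 : (⟨a, b⟩ : ℂ) ≠ 0 := norm_ne_zero_iff.1 (by rw [hn]; exact one_ne_zero)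
  refine ⟨Complex.arg ⟨a, b⟩, Complex.arg_mem_Ioc _, ?_, ?_⟩
  · simp [Complex.cos_arg h0, hn]
  · simp [Complex.sin_arg, hn]

theorem exists_orthonormal_param {K : Submodule ℝ E3} (hK : Module.finrank ℝ K = 2)
    {x : UnitSphere} (hx : (x : E3) ∈ K) :
    ∃ y ∈ K, ‖y‖ = 1 ∧ inner ℝ (x : E3) y = 0 ∧
      ∀ z : UnitSphere, (z : E3) ∈ K →
        ∃ θ ∈ Set.Ioc (-π) π, (z : E3) = cos θ • (x : E3) + sin θ • y := by
  let b : OrthonormalBasis (Fin 2) ℝ K := (stdOrthonormalBasis ℝ K).reindex (finCongr hK)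
  have hb : ∀ i j, inner ℝ (b i : E3) (b j : E3) = if i = j then (1 : ℝ) else 0 := fun i j =>
    orthonormal_iff_ite.1 b.orthonormal i j
  have expand : ∀ z : UnitSphere, (z : E3) ∈ K →
      ∃ s t : ℝ, (z : E3) = s • (b 0 : E3) + t • (b 1 : E3) ∧ s ^ 2 + t ^ 2 = 1 := fun z hz => by
    refine ⟨b.repr ⟨z, hz⟩ 0, b.repr ⟨z, hz⟩ 1, ?_, ?_⟩
    · have := congrArg Subtype.val (b.sum_repr ⟨z, hz⟩)
      simpa [Fin.sum_univ_two] using this.symm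
    · have h1 := b.repr.norm_map ⟨z, hz⟩
      rw [EuclideanSpace.norm_eq, Fin.sum_univ_two, Submodule.coe_norm, norm_eq_of_mem_sphere z,
        sqrt_eq_one] at h1
      simpa using h1
  obtain ⟨a, c, hxe, hac⟩ := expand x hx
  -- The quarter turn of `x` inside `K`.
  refine ⟨(-c) • (b 0 : E3) + a • (b 1 : E3),
    K.add_mem (K.smul_mem _ (b 0).2) (K.smul_mem _ (b 1).2), ?_, ?_, fun z hz => ?_⟩
  · rw [← sq_eq_sq₀ (norm_nonneg _) zero_le_one, ← real_inner_self_eq_norm_sq]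
    simp only [inner_add_left, inner_add_right, real_inner_smul_left, real_inner_smul_right, hb]
    simp only [if_true, Fin.isValue, zero_ne_one, one_ne_zero, if_false]
    linarith [hac]
  · rw [hxe]
    simp only [inner_add_left, inner_add_right, real_inner_smul_left, real_inner_smul_right, hb]
    simp only [if_true, Fin.isValue, zero_ne_one, one_ne_zero, if_false]
    ring
  · obtain ⟨s, t, hze, hst⟩ := expand z hz
    -- The two squared numbers are the coordinates of `z` with respect to `x` and its quarter turn.
    have h1 : (a * s + c * t) ^ 2 + (a * t - c * s) ^ 2 = 1 := by
      calc _ = (a ^ 2 + c ^ 2) * (s ^ 2 + t ^ 2) := by ring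
        _ = 1 := by rw [hac, hst, one_mul]
    obtain ⟨θ, hθ, hc, hs⟩ := exists_cos_sin_eq h1
    refine ⟨θ, hθ, ?_⟩
    rw [← hc, ← hs, hxe, hze]
    have e1 : s = (a * s + c * t) * a + (a * t - c * s) * (-c) := by linear_combination -s * hac
    have e2 : t = (a * s + c * t) * c + (a * t - c * s) * a := by linear_combination -t * hac
    rw [smul_add, smul_add, smul_smul, smul_smul, smul_smul, smul_smul, add_add_add_comm,
      ← add_smul, ← add_smul, ← e1, ← e2]

theorem cos_add_mul_sin_arctan (t θ : ℝ) :
    cos θ + t * sin θ = cos (θ - arctan t) / cos (arctan t) := by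
  have h : cos (arctan t) ≠ 0 := (cos_arctan_pos t).ne'
  have ht : t = sin (arctan t) / cos (arctan t) := by rw [← tan_eq_sin_div_cos, tan_arctan]
  rw [cos_sub, eq_div_iff h]
  nth_rewrite 1 [ht]
  field_simp

/-- After the phase shift by `arctan t` the sign is that of a cosine. For `θ` in `[-π, π]` the
shifted angle has absolute value below `3π/2`, so only one window of positivity occurs. -/
theorem cos_add_mul_sin_pos_iff {t θ : ℝ} (hθ : θ ∈ Set.Icc (-π) π) :
    0 < cos θ + t * sin θ ↔ arctan t - π / 2 < θ ∧ θ < arctan t + π / 2 := by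
  have h1 := neg_pi_div_two_lt_arctan t
  have h2 := arctan_lt_pi_div_two t
  rw [cos_add_mul_sin_arctan, div_pos_iff_of_pos_right (cos_arctan_pos t)]
  constructor
  · intro h
    constructor
    · by_contra! hle
      rw [← cos_neg] at h
      exact h.not_ge (cos_nonpos_of_pi_div_two_le_of_le (by linarith) (by linarith [hθ.1]))
    · by_contra! hle
      exact h.not_ge (cos_nonpos_of_pi_div_two_le_of_le (by linarith) (by linarith [hθ.2]))
  · rintro ⟨h3, h4⟩
    exact cos_pos_of_mem_Ioo ⟨by linarith, by linarith⟩

/-- The point at angle `θ` of the great circle through `x` in the direction `y`. -/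
def greatCirclePoint (x : UnitSphere) (y : E3) (hy : ‖y‖ = 1) (hxy : inner ℝ (x : E3) y = 0)
    (θ : ℝ) : UnitSphere :=
  ⟨cos θ • (x : E3) + sin θ • y, by
    rw [mem_sphere_zero_iff_norm, ← sq_eq_sq₀ (norm_nonneg _) zero_le_one,
      norm_add_sq_real, norm_smul, norm_smul, hy, norm_eq_of_mem_sphere, real_inner_smul_left,
      real_inner_smul_right, hxy]
    simp⟩

theorem continuous_greatCirclePoint {x : UnitSphere} {y : E3} {hy : ‖y‖ = 1}
    {hxy : inner ℝ (x : E3) y = 0} : Continuous (greatCirclePoint x y hy hxy) :=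
  Continuous.subtype_mk (by fun_prop) _

theorem greatCirclePoint_inj {x : UnitSphere} {y : E3} {hy : ‖y‖ = 1}
    {hxy : inner ℝ (x : E3) y = 0} {θ φ : ℝ} (hθφ : |θ - φ| ≤ π)
    (h : greatCirclePoint x y hy hxy θ = greatCirclePoint x y hy hxy φ) : θ = φ := by
  have h := congrArg Subtype.val h
  simp only [greatCirclePoint] at h
  have hx1 : inner ℝ (x : E3) (x : E3) = 1 := by
    rw [real_inner_self_eq_norm_sq, norm_eq_of_mem_sphere]; norm_num
  have hc : cos θ = cos φ := by
    have := congrArg (inner ℝ (x : E3)) h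
    simpa [inner_add_right, real_inner_smul_right, hxy, hx1] using this
  have hs : sin θ = sin φ := by
    have := congrArg (inner ℝ y) h
    rw [real_inner_comm] at hxy
    simpa [inner_add_right, real_inner_smul_right, hxy, hy] using this
  have h1 : cos (θ - φ) = 1 := by
    rw [cos_sub, hc, hs, ← sq, ← sq, cos_sq_add_sin_sq]
  have := (cos_eq_one_iff_of_lt_of_lt (by linarith [(abs_le.1 hθφ).1, pi_pos])
    (by linarith [(abs_le.1 hθφ).2, pi_pos])).1 h1
  linarith

/-- Parametrize the great circle by angle, with `x` at angle zero. Each other form keeps its sign on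
an open window of length `π`, and the facet is the intersection of these windows. Its ends are zeros
of a further form, hence crossings. -/
theorem isOpenArc_signFacet [Finite ι] [Nontrivial ι] {i : ι}
    (hrank : Module.finrank ℝ (LinearMap.ker (f i)) = 2) {x : UnitSphere}
    (hx : IsFacetPoint (sphereFun f) i x) :
    ∃ p q, p ∈ multipleZeros (sphereFun f) ∧ q ∈ multipleZeros (sphereFun f) ∧
      IsOpenArc (signFacet (sphereFun f) i x) p q := by
  obtain ⟨y, hyK, hy, hxy, hparam⟩ := exists_orthonormal_param hrank (x := x) hx.1
  set e := greatCirclePoint x y hy hxy with he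
  have hei : ∀ θ, sphereFun f i (e θ) = 0 := fun θ => by
    have h1 : f i x = 0 := hx.1
    have h2 : f i y = 0 := hyK
    simp [sphereFun, he, greatCirclePoint, h1, h2]
  let α : {j // j ≠ i} → ℝ := fun j => arctan (f j y / f j x)
  have hej : ∀ (j : {j // j ≠ i}) θ, sphereFun f j (e θ) =
      f j x * (cos θ + f j y / f j x * sin θ) := fun j θ => by
    have h1 : f j x ≠ 0 := hx.2 j j.2
    simp only [sphereFun, he, greatCirclePoint, map_add, map_smul, smul_eq_mul]
    field_simp
  have hpos : ∀ (j : {j // j ≠ i}) θ, θ ∈ Set.Icc (-π) π →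
      (0 < sphereFun f j x * sphereFun f j (e θ) ↔ α j - π / 2 < θ ∧ θ < α j + π / 2) :=
    fun j θ hθ => by
      have h1 : f j x ≠ 0 := hx.2 j j.2
      rw [hej, ← cos_add_mul_sin_pos_iff hθ, sphereFun, ← mul_assoc]
      exact mul_pos_iff_of_pos_left (mul_self_pos.2 h1)
  have hzero : ∀ (j : {j // j ≠ i}) θ, |θ - α j| = π / 2 → sphereFun f j (e θ) = 0 :=
    fun j θ hθ => by
      rw [hej, cos_add_mul_sin_arctan, ← cos_abs (θ - _), hθ, cos_pi_div_two, zero_div, mul_zero]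
  have : Nonempty {j // j ≠ i} := let ⟨j, hj⟩ := exists_ne i; ⟨⟨j, hj⟩⟩
  -- The window with the largest centre opens last and the one with the smallest centre closes
  -- first; they bound the intersection.
  obtain ⟨m, hm⟩ := Finite.exists_max α
  obtain ⟨n, hn⟩ := Finite.exists_min α
  set lo := α m - π / 2 with hlo
  set hi := α n + π / 2 with hhi
  have hm1 : -(π / 2) < α m := neg_pi_div_two_lt_arctan _
  have hm2 : α m < π / 2 := arctan_lt_pi_div_two _
  have hn1 : -(π / 2) < α n := neg_pi_div_two_lt_arctan _
  have hn2 : α n < π / 2 := arctan_lt_pi_div_two _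
  have hlohi : lo < hi := by linarith
  have hlen : hi - lo ≤ π := by linarith [hm n]
  have hpi := pi_pos
  have hrange : ∀ t : unitInterval, (t : ℝ) * (hi - lo) ∈ Set.Icc 0 (hi - lo) := fun t =>
    ⟨mul_nonneg t.2.1 (by linarith), mul_le_of_le_one_left (by linarith) t.2.2⟩
  refine ⟨e lo, e hi, ⟨i, m, m.2.symm, hei _, hzero m _ ?_⟩, ⟨i, n, n.2.symm, hei _, hzero n _ ?_⟩,
    fun t => e (lo + t * (hi - lo)), ?_, ?_, ?_, ?_, ?_⟩
  · rw [hlo, sub_sub_cancel_left, abs_neg, abs_of_pos (by linarith)]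
  · rw [hhi, add_sub_cancel_left, abs_of_pos (by linarith)]
  · exact continuous_greatCirclePoint.comp (by fun_prop)
  · intro s t hst
    have := greatCirclePoint_inj (by
      have h1 := hrange s
      have h2 := hrange t
      rw [abs_le]
      constructor <;> linarith [h1.1, h1.2, h2.1, h2.2]) hst
    have h3 : (s : ℝ) * (hi - lo) = t * (hi - lo) := by linarith
    exact Subtype.ext (mul_right_cancel₀ (by linarith) h3)
  · simp
  · simp
  · ext z
    constructor
    · intro hz
      obtain ⟨θ, hθ, hzθ⟩ := hparam z hz.1
      have hze : z = e θ := Subtype.ext hzθ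
      subst hze
      have h1 := ((hpos m θ ⟨hθ.1.le, hθ.2⟩).1 (hz.2 m m.2)).1
      have h2 := ((hpos n θ ⟨hθ.1.le, hθ.2⟩).1 (hz.2 n n.2)).2
      have hd : 0 < hi - lo := by linarith
      have h3 : 0 < (θ - lo) / (hi - lo) := div_pos (by linarith) hd
      have h4 : (θ - lo) / (hi - lo) < 1 := (div_lt_one hd).2 (by linarith)
      refine ⟨⟨(θ - lo) / (hi - lo), h3.le, h4.le⟩, ⟨h3, h4⟩, ?_⟩
      simp only [div_mul_cancel₀ _ hd.ne', add_sub_cancel]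
    · rintro ⟨t, ⟨ht0, ht1⟩, rfl⟩
      have ht0' : (0 : ℝ) < t := ht0
      have ht1' : (t : ℝ) < 1 := ht1
      have h1 : 0 < t * (hi - lo) := mul_pos ht0' (by linarith)
      have h2 : t * (hi - lo) < hi - lo := mul_lt_of_lt_one_left (by linarith) ht1'
      refine ⟨hei _, fun j hj => ?_⟩
      have h3 := hm ⟨j, hj⟩
      have h4 := hn ⟨j, hj⟩
      exact (hpos ⟨j, hj⟩ _ ⟨by linarith, by linarith⟩).2 ⟨by linarith, by linarith⟩

end FacetArcs

/-! ### The dual drawing -/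

section DualDrawing

theorem smul_radial {v : E3} (hv : v ≠ 0) : ‖v‖ • (radial v hv : E3) = v := by
  simp [radial, smul_smul, norm_ne_zero_iff.2 hv]

theorem radial_eq_of_eq_smul {v : E3} {hv : v ≠ 0} {z : UnitSphere} {c : ℝ} (hc : 0 < c)
    (h : v = c • (z : E3)) : radial v hv = z := by
  have hn : ‖v‖ = c := by rw [h, norm_smul, norm_eq_of_mem_sphere, mul_one, Real.norm_of_nonneg hc.le]
  refine Subtype.ext ?_
  simp only [radial, hn]
  rw [h, smul_smul, inv_mul_cancel₀ hc.ne', one_smul]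

theorem eq_smul_of_radial_eq {v w : E3} {hv : v ≠ 0} {hw : w ≠ 0} (h : radial v hv = radial w hw) :
    v = (‖v‖ / ‖w‖) • w := by
  rw [div_eq_mul_inv, mul_smul]
  calc v = ‖v‖ • (radial v hv : E3) := (smul_radial hv).symm
    _ = _ := by rw [h]; rfl

/-- The great circle arc from `p` to `x`, without its end point `p`. -/
def halfArc (p x : UnitSphere) : Set UnitSphere :=
  {z | ∃ a b : ℝ, 0 ≤ a ∧ 0 < b ∧ (z : E3) = a • (p : E3) + b • (x : E3)}

theorem eq_of_smul_eq_smul {x y : UnitSphere} {a b : ℝ} (ha : 0 ≤ a) (hb : 0 ≤ b)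
    (h : a • (x : E3) = b • (y : E3)) : a = b := by
  have := congrArg norm h
  rwa [norm_smul, norm_smul, norm_eq_of_mem_sphere, norm_eq_of_mem_sphere, mul_one, mul_one,
    Real.norm_of_nonneg ha, Real.norm_of_nonneg hb] at this

/-- Applying `φ` compares the coefficients of `p`, and then those of `x` can be compared. Each pair
sums to one, so `r = 1`. -/
theorem eq_of_combination_eq_smul {φ : E3 →ₗ[ℝ] ℝ} {p x : UnitSphere} (hp : φ p ≠ 0)
    (hx : φ x = 0) {a b r : ℝ}
    (h : (1 - a) • (p : E3) + a • (x : E3) = r • ((1 - b) • (p : E3) + b • (x : E3))) : a = b := by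
  have h1 : 1 - a = r * (1 - b) := by
    have := congrArg φ h
    simp only [map_add, map_smul, smul_eq_mul, hx, mul_zero, add_zero, ← mul_assoc] at this
    exact mul_right_cancel₀ hp this
  have h2 : a = r * b := by
    rw [smul_add, smul_smul, smul_smul, h1] at h
    exact smul_left_injective ℝ (unitSphere_ne_zero x) (add_left_cancel h)
  have h3 : r = 1 := by linarith
  rw [h2, h3, one_mul]

/-- Project the broken line from `p` through `x` to `q` radially. Since `φ` is positive before `x`
and negative after it, the broken line avoids the origin and its two halves project to arcs that
share only `x`. -/
theorem isOpenArc_halfArc_union {φ : E3 →ₗ[ℝ] ℝ} {p q x : UnitSphere} (hp : 0 < φ p)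
    (hx : φ x = 0) (hq : φ q < 0) : IsOpenArc (halfArc p x ∪ halfArc q x) p q := by
  -- The corner `x` is reached at time `1 / 2`. Writing the piecewise linear path with `max` and
  -- absolute value makes continuity automatic.
  let k : unitInterval → E3 := fun t => max (1 - 2 * (t : ℝ)) 0 • (p : E3) +
    (1 - |2 * (t : ℝ) - 1|) • (x : E3) + max (2 * (t : ℝ) - 1) 0 • (q : E3)
  have hk1 : ∀ t : unitInterval, (t : ℝ) ≤ 1 / 2 →
      k t = (1 - 2 * (t : ℝ)) • (p : E3) + (2 * (t : ℝ)) • (x : E3) := fun t ht => by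
    simp only [k]
    rw [max_eq_left (by linarith), max_eq_right (by linarith), abs_of_nonpos (by linarith),
      zero_smul, add_zero]
    congr 2
    ring
  have hk2 : ∀ t : unitInterval, 1 / 2 ≤ (t : ℝ) →
      k t = (1 - (2 - 2 * (t : ℝ))) • (q : E3) + (2 - 2 * (t : ℝ)) • (x : E3) := fun t ht => by
    simp only [k]
    rw [max_eq_right (by linarith), max_eq_left (by linarith), abs_of_nonneg (by linarith),
      zero_smul, zero_add, add_comm]
    congr 2 <;> ring
  have hφ1 : ∀ t : unitInterval, (t : ℝ) ≤ 1 / 2 → φ (k t) = (1 - 2 * t) * φ p := fun t ht => by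
    rw [hk1 t ht]; simp [hx]
  have hφ2 : ∀ t : unitInterval, 1 / 2 ≤ (t : ℝ) → φ (k t) = (2 * t - 1) * φ q := fun t ht => by
    rw [hk2 t ht, map_add, map_smul, map_smul, hx, smul_eq_mul, smul_zero]; ring
  have hk0 : ∀ t, k t ≠ 0 := fun t h0 => by
    rcases lt_trichotomy (t : ℝ) (1 / 2) with ht | ht | ht
    · have := hφ1 t ht.le
      rw [h0, map_zero] at this
      exact (mul_pos (by linarith) hp).ne this
    · have := hk1 t ht.le
      rw [h0, ht] at this
      norm_num at this
      exact unitSphere_ne_zero x this.symm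
    · have := hφ2 t ht.le
      rw [h0, map_zero] at this
      exact (mul_neg_of_pos_of_neg (by linarith) hq).ne' this
  have hkc : Continuous k := by fun_prop
  have hcross : ∀ s t : unitInterval, (s : ℝ) ≤ 1 / 2 → 1 / 2 ≤ (t : ℝ) → ∀ r : ℝ, 0 < r →
      k s = r • k t → s = t := fun s t hs ht r hr h => by
    have := congrArg φ h
    rw [map_smul, hφ1 s hs, hφ2 t ht, smul_eq_mul] at this
    have h1 : 0 ≤ (1 - 2 * (s : ℝ)) * φ p := mul_nonneg (by linarith) hp.le
    have h2 : (2 * (t : ℝ) - 1) * φ q ≤ 0 := mul_nonpos_of_nonneg_of_nonpos (by linarith) hq.le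
    have h3 : r * ((2 * (t : ℝ) - 1) * φ q) ≤ 0 := mul_nonpos_of_nonneg_of_nonpos hr.le h2
    have h4 : (1 - 2 * (s : ℝ)) = 0 :=
      (mul_eq_zero.1 (le_antisymm (this.le.trans h3) h1)).resolve_right hp.ne'
    have h5 : (2 * (t : ℝ) - 1) = 0 :=
      (mul_eq_zero.1 ((mul_eq_zero.1 (le_antisymm h3 (h1.trans this.le))).resolve_left
        hr.ne')).resolve_right hq.ne
    exact Subtype.ext (by linarith)
  refine ⟨fun t => radial (k t) (hk0 t), continuous_radial hkc hk0, ?_, ?_, ?_, ?_⟩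
  · intro s t hst
    have hst : radial (k s) (hk0 s) = radial (k t) (hk0 t) := hst
    have hs := norm_pos_iff.2 (hk0 s)
    have ht := norm_pos_iff.2 (hk0 t)
    have h := eq_smul_of_radial_eq hst
    have h' := eq_smul_of_radial_eq hst.symm
    rcases le_total (s : ℝ) (1 / 2) with hs2 | hs2 <;> rcases le_total (t : ℝ) (1 / 2) with ht2 | ht2
    · rw [hk1 s hs2] at h
      nth_rewrite 2 [hk1 t ht2] at h
      have := eq_of_combination_eq_smul hp.ne' hx h
      exact Subtype.ext (by linarith)
    · exact hcross s t hs2 ht2 _ (div_pos hs ht) h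
    · exact (hcross t s ht2 hs2 _ (div_pos ht hs) h').symm
    · rw [hk2 s hs2] at h
      nth_rewrite 2 [hk2 t ht2] at h
      have := eq_of_combination_eq_smul hq.ne hx h
      exact Subtype.ext (by linarith)
  · refine radial_eq_of_eq_smul one_pos ?_
    rw [hk1 _ (by simp)]; simp
  · refine radial_eq_of_eq_smul one_pos ?_
    rw [hk2 _ (by norm_num)]; norm_num
  · ext z
    constructor
    · rintro (⟨a, b, ha, hb, hz⟩ | ⟨a, b, ha, hb, hz⟩)
      · have hab : 0 < a + b := by linarith
        have hb1 : b / (a + b) ≤ 1 := (div_le_one hab).2 (by linarith)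
        have hb0 : 0 < b / (a + b) := div_pos hb hab
        -- Dividing by `a + b` moves `z` along its ray onto the segment from `p` to `x`; the extra
        -- half is the speed of the path.
        refine ⟨⟨b / (a + b) / 2, by linarith, by linarith⟩,
          ⟨?_, ?_⟩, radial_eq_of_eq_smul (inv_pos.2 hab) ?_⟩
        · exact Subtype.mk_lt_mk.2 (by linarith)
        · exact Subtype.mk_lt_mk.2 (by linarith)
        · rw [hk1 _ (by simp only; linarith), hz, smul_add, smul_smul, smul_smul]
          congr 2 <;> · field_simp; try ring
      · have hab : 0 < a + b := by linarith
        have hb1 : b / (a + b) ≤ 1 := (div_le_one hab).2 (by linarith)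
        have hb0 : 0 < b / (a + b) := div_pos hb hab
        refine ⟨⟨1 - b / (a + b) / 2, by linarith, by linarith⟩,
          ⟨?_, ?_⟩, radial_eq_of_eq_smul (inv_pos.2 hab) ?_⟩
        · exact Subtype.mk_lt_mk.2 (by linarith)
        · exact Subtype.mk_lt_mk.2 (by linarith)
        · rw [hk2 _ (by simp only; linarith), hz, smul_add, smul_smul, smul_smul]
          congr 2 <;> · field_simp; try ring
    · rintro ⟨t, ⟨ht0, ht1⟩, rfl⟩
      have ht0' : (0 : ℝ) < t := ht0
      have ht1' : (t : ℝ) < 1 := ht1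
      have hn := inv_pos.2 (norm_pos_iff.2 (hk0 t))
      rcases le_total (t : ℝ) (1 / 2) with ht | ht
      · refine Or.inl ⟨‖k t‖⁻¹ * (1 - 2 * t), ‖k t‖⁻¹ * (2 * t), mul_nonneg hn.le (by linarith),
          mul_pos hn (by linarith), ?_⟩
        rw [mul_smul, mul_smul, ← smul_add, ← hk1 t ht]
        rfl
      · refine Or.inr ⟨‖k t‖⁻¹ * (1 - (2 - 2 * t)), ‖k t‖⁻¹ * (2 - 2 * t),
          mul_nonneg hn.le (by linarith), mul_pos hn (by linarith), ?_⟩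
        rw [mul_smul, mul_smul, ← smul_add, ← hk2 t ht]
        rfl

end DualDrawing

/-! ### Incidence of cells and facets, and the dual graph -/

section Duality

variable {ι V : Type*} {f : ι → E3 →ₗ[ℝ] ℝ} {G : SimpleGraph V} {c : V → UnitSphere}

/-- The points `c v` represent the cells of the arrangement of great circles, each cell once, and
`G` is the graph of cells. -/
structure IsCellLabelling (f : ι → E3 →ₗ[ℝ] ℝ) (G : SimpleGraph V) (c : V → UnitSphere) :
    Prop where
  ne_zero : ∀ v i, sphereFun f i (c v) ≠ 0
  eq_of_mem : ∀ u v, c u ∈ signCell (sphereFun f) (c v) → u = v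
  exists_mem : ∀ x, (∀ i, sphereFun f i x ≠ 0) → ∃ v, c v ∈ signCell (sphereFun f) x
  adj_iff : ∀ u v, G.Adj u v ↔ u ≠ v ∧ ∃ a ∈ signFacets (sphereFun f),
    a ⊆ closure (signCell (sphereFun f) (c u)) ∧ a ⊆ closure (signCell (sphereFun f) (c v))

namespace IsCellLabelling

theorem incident_iff [Nonempty ι] (h : IsCellLabelling f G c) {i : ι} {x : UnitSphere}
    (hx : IsFacetPoint (sphereFun f) i x) (v : V) :
    signFacet (sphereFun f) i x ⊆ closure (signCell (sphereFun f) (c v)) ↔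
      ∀ j, j ≠ i → 0 < sphereFun f j x * sphereFun f j (c v) :=
  signFacet_subset_closure_iff hasClosedCells_sphereFun hx (h.ne_zero v)

/-- Both cells agree with the facet on all forms but `f i`; agreement on `f i` as well would make
them equal. -/
theorem mul_neg_of_incident [Nonempty ι] (h : IsCellLabelling f G c) {i : ι} {x : UnitSphere}
    (hx : IsFacetPoint (sphereFun f) i x) {u v : V} (huv : u ≠ v)
    (hu : signFacet (sphereFun f) i x ⊆ closure (signCell (sphereFun f) (c u)))
    (hv : signFacet (sphereFun f) i x ⊆ closure (signCell (sphereFun f) (c v))) :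
    sphereFun f i (c u) * sphereFun f i (c v) < 0 := by
  rw [h.incident_iff hx] at hu hv
  by_contra! hle
  have hpos := lt_of_le_of_ne hle (mul_ne_zero (h.ne_zero u i) (h.ne_zero v i)).symm
  refine huv (h.eq_of_mem v u fun j => ?_).symm
  by_cases hj : j = i
  · rwa [hj]
  · exact mul_pos_trans (mul_pos_symm (hu j hj)) (hv j hj)

/-- Three nonzero reals cannot have pairwise opposite signs. -/
theorem eq_or_eq_of_incident [Nonempty ι] (h : IsCellLabelling f G c) {a : Set UnitSphere}
    (ha : a ∈ signFacets (sphereFun f)) {u v w : V} (huv : u ≠ v)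
    (hu : a ⊆ closure (signCell (sphereFun f) (c u)))
    (hv : a ⊆ closure (signCell (sphereFun f) (c v)))
    (hw : a ⊆ closure (signCell (sphereFun f) (c w))) : w = u ∨ w = v := by
  obtain ⟨i, x, hx, rfl⟩ := ha
  by_contra! hne
  have h1 := h.mul_neg_of_incident hx huv hu hv
  have h2 := h.mul_neg_of_incident hx hne.1 hw hu
  have h3 := h.mul_neg_of_incident hx hne.2 hw hv
  have h4 := mul_pos_of_neg_of_neg h2 h3
  have h5 := mul_self_nonneg (sphereFun f i (c w))
  nlinarith

/-- The form of a shared facet is the only one separating the two cells, and the signs of the others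
on the facet are read off from either cell. -/
theorem facet_unique [Nonempty ι] (h : IsCellLabelling f G c) {a b : Set UnitSphere}
    (ha : a ∈ signFacets (sphereFun f)) (hb : b ∈ signFacets (sphereFun f)) {u v : V} (huv : u ≠ v)
    (hau : a ⊆ closure (signCell (sphereFun f) (c u)))
    (hav : a ⊆ closure (signCell (sphereFun f) (c v)))
    (hbu : b ⊆ closure (signCell (sphereFun f) (c u)))
    (hbv : b ⊆ closure (signCell (sphereFun f) (c v))) : a = b := by
  obtain ⟨i, x, hx, rfl⟩ := ha
  obtain ⟨j, y, hy, rfl⟩ := hb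
  have hneg := h.mul_neg_of_incident hy huv hbu hbv
  rw [h.incident_iff hx] at hau hav
  rw [h.incident_iff hy] at hbu hbv
  obtain rfl : j = i := by
    by_contra hij
    exact hneg.not_gt (mul_pos_trans (mul_pos_symm (hau j hij)) (hav j hij))
  exact (signFacet_eq_of_mem (y := y)
    ⟨hy.1, fun k hk => mul_pos_trans (hau k hk) (mul_pos_symm (hbu k hk))⟩).symm

/-- A small step from `x` in direction `m` keeps the finitely many other signs and gives `f i` the
sign of `f i m`. Using `m` and `-m` yields the cells on both sides. -/
theorem exists_incident_of_side [Finite ι] [Nonempty ι] (h : IsCellLabelling f G c)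
    {i : ι} {x : UnitSphere} (hx : IsFacetPoint (sphereFun f) i x) {m : E3} (hm : f i m ≠ 0) :
    ∃ v, signFacet (sphereFun f) i x ⊆ closure (signCell (sphereFun f) (c v)) ∧
      0 < f i m * sphereFun f i (c v) := by
  have hev : ∀ᶠ t : ℝ in nhdsWithin 0 (Set.Ioi 0), ∀ j, j ≠ i → 0 < f j x * f j (x + t • m) := by
    refine Filter.eventually_all.2 fun j => ?_
    by_cases hj : j = i
    · exact Filter.Eventually.of_forall fun t h' => absurd hj h'
    · have hcont : Continuous fun t : ℝ => f j x * (f j x + t * f j m) := by fun_prop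
      have h0 : 0 < f j x * (f j x + 0 * f j m) := by
        rw [zero_mul, add_zero]
        exact mul_self_pos.2 (hx.2 j hj)
      filter_upwards [nhdsWithin_le_nhds (hcont.continuousAt.eventually (lt_mem_nhds h0))]
        with t ht _
      simpa using ht
  obtain ⟨t, ht, ht0⟩ := (hev.and self_mem_nhdsWithin).exists
  have hxi : f i x = 0 := hx.1
  have hti : f i (x + t • m) = t * f i m := by simp [hxi]
  have hy0 : (x : E3) + t • m ≠ 0 := fun h0 => by
    rw [h0, map_zero] at hti
    exact mul_ne_zero (ne_of_gt ht0) hm hti.symm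
  obtain ⟨v, hv⟩ := h.exists_mem (radial _ hy0) fun j => by
    rw [Ne, sphereFun_radial_eq_zero_iff]
    by_cases hj : j = i
    · rw [hj, planeFun, hti]
      exact mul_ne_zero (ne_of_gt ht0) hm
    · exact right_ne_zero_of_mul (ht j hj).ne'
  refine ⟨v, (h.incident_iff hx v).2 fun j hj => ?_, ?_⟩
  · exact mul_pos_trans (mul_sphereFun_radial_pos_iff.2 (ht j hj)) (hv j)
  · refine mul_pos_trans (mul_sphereFun_radial_pos_iff.2 ?_) (hv i)
    rw [planeFun, hti, mul_left_comm]
    exact mul_pos ht0 (mul_self_pos.2 hm)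

theorem exists_incident_pair [Finite ι] [Nonempty ι] (h : IsCellLabelling f G c)
    (hf : ∀ i, f i ≠ 0) {a : Set UnitSphere} (ha : a ∈ signFacets (sphereFun f)) :
    ∃ u v, u ≠ v ∧ a ⊆ closure (signCell (sphereFun f) (c u)) ∧
      a ⊆ closure (signCell (sphereFun f) (c v)) := by
  obtain ⟨i, x, hx, rfl⟩ := ha
  obtain ⟨m, hm⟩ := DFunLike.ne_iff.1 (hf i)
  rw [LinearMap.zero_apply] at hm
  obtain ⟨u, hu, hu'⟩ := h.exists_incident_of_side hx hm
  obtain ⟨v, hv, hv'⟩ := h.exists_incident_of_side hx (m := -m) (by simpa using hm)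
  refine ⟨u, v, ?_, hu, hv⟩
  rintro rfl
  rw [map_neg] at hv'
  linarith

theorem exists_edge_equiv [Finite ι] [Nonempty ι] (h : IsCellLabelling f G c)
    (hf : ∀ i, f i ≠ 0) :
    ∃ ψ : G.edgeSet ≃ signFacets (sphereFun f), ∀ e : G.edgeSet, ∀ v ∈ (e : Sym2 V),
      (ψ e : Set UnitSphere) ⊆ closure (signCell (sphereFun f) (c v)) := by
  have hex : ∀ e : G.edgeSet, ∃ a : signFacets (sphereFun f), ∀ v ∈ (e : Sym2 V),
      (a : Set UnitSphere) ⊆ closure (signCell (sphereFun f) (c v)) := by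
    rintro ⟨e, he⟩
    induction e using Sym2.ind with
    | _ u v =>
      obtain ⟨-, a, ha, hau, hav⟩ := (h.adj_iff u v).1 he
      refine ⟨⟨a, ha⟩, fun w hw => ?_⟩
      rcases Sym2.mem_iff.1 hw with rfl | rfl
      exacts [hau, hav]
  choose ψ hψ using hex
  refine ⟨Equiv.ofBijective ψ ⟨?_, ?_⟩, hψ⟩
  · rintro ⟨e, he⟩ ⟨e', he'⟩ heq
    induction e using Sym2.ind with
    | _ u v =>
    induction e' using Sym2.ind with
    | _ u' v' =>
      have h1 := hψ ⟨_, he⟩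
      have h2 := hψ ⟨_, he'⟩
      rw [← heq] at h2
      have key : ∀ w ∈ s(u', v'), w = u ∨ w = v := fun w hw =>
        h.eq_or_eq_of_incident (ψ ⟨_, he⟩).2 (G.ne_of_adj he) (h1 u (Sym2.mem_mk_left u v))
          (h1 v (Sym2.mem_mk_right u v)) (h2 w hw)
      have hne : u' ≠ v' := G.ne_of_adj he'
      refine Subtype.ext (Sym2.eq_iff.2 ?_)
      rcases key u' (Sym2.mem_mk_left _ _) with rfl | rfl <;>
      rcases key v' (Sym2.mem_mk_right _ _) with rfl | rfl
      · exact absurd rfl hne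
      · exact Or.inl ⟨rfl, rfl⟩
      · exact Or.inr ⟨rfl, rfl⟩
      · exact absurd rfl hne
  · rintro ⟨a, ha⟩
    obtain ⟨u, v, huv, hu, hv⟩ := h.exists_incident_pair hf ha
    have hadj := (h.adj_iff u v).2 ⟨huv, a, ha, hu, hv⟩
    refine ⟨⟨s(u, v), hadj⟩, Subtype.ext ?_⟩
    exact h.facet_unique (ψ _).2 ha huv (hψ ⟨s(u, v), hadj⟩ u (Sym2.mem_mk_left _ _))
      (hψ ⟨s(u, v), hadj⟩ v (Sym2.mem_mk_right _ _)) hu hv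

theorem eq_or_mem_of_mem_halfArc [Nonempty ι] (h : IsCellLabelling f G c)
    {x z : UnitSphere} {v : V} (hx : x ∈ closure (signCell (sphereFun f) (c v)))
    (hz : z ∈ halfArc (c v) x) : z = x ∨ z ∈ signCell (sphereFun f) (c v) := by
  obtain ⟨a, b, ha, hb, hzab⟩ := hz
  rcases ha.eq_or_lt with rfl | ha
  · left
    rw [zero_smul, zero_add] at hzab
    have hb1 : (1 : ℝ) = b := eq_of_smul_eq_smul (x := z) (y := x) zero_le_one hb.le (by
      rw [one_smul, hzab])
    rw [← hb1, one_smul] at hzab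
    exact Subtype.ext hzab
  · right
    have := add_smul_mem_signCell (f := f) (c := c v) (y := x) (h.ne_zero v)
      ((hasClosedCells_sphereFun _ _ (h.ne_zero v)).1 hx) hb.le ha
    rw [add_comm, ← hzab] at this
    exact this

/-- Apply `f i`, which kills `x`: the excess of `a` over `a'` times `f i (c v)` equals `b' * f i y`,
and `y` is on the closed side of `c v`. -/
theorem coeff_le_of_combination_eq [Nonempty ι] (h : IsCellLabelling f G c)
    {x y : UnitSphere} {v : V} {i : ι} (hx : sphereFun f i x = 0)
    (hy : y ∈ closure (signCell (sphereFun f) (c v))) {a b a' b' : ℝ} (hb' : 0 ≤ b')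
    (heq : a • (c v : E3) + b • (x : E3) = a' • (c v : E3) + b' • (y : E3)) : a' ≤ a := by
  by_contra! hlt
  have h1 := (hasClosedCells_sphereFun _ _ (h.ne_zero v)).1 hy i
  have h2 := congrArg (f i) heq
  have hx : f i x = 0 := hx
  have h3 : f i (c v) ≠ 0 := h.ne_zero v i
  simp only [map_add, map_smul, smul_eq_mul, hx, mul_zero, add_zero] at h2
  have h4 : 0 < (a' - a) * (f i (c v) * f i (c v)) :=
    mul_pos (by linarith) (mul_self_pos.2 h3)
  have h5 : 0 ≤ b' * (f i (c v) * f i y) := mul_nonneg hb' h1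
  have h6 : (a' - a) * (f i (c v) * f i (c v)) + b' * (f i (c v) * f i y) = 0 := by
    linear_combination (-f i (c v)) * h2
  linarith

/-- A ray from `c v` meets the boundary of its cell once. Both `x` and `y` being on the boundary,
the coefficient bound applies in both directions. -/
theorem eq_of_mem_halfArc_inter [Nonempty ι] (h : IsCellLabelling f G c)
    {x y z : UnitSphere} {v : V} {i j : ι} (hxi : sphereFun f i x = 0) (hyj : sphereFun f j y = 0)
    (hx : x ∈ closure (signCell (sphereFun f) (c v)))
    (hy : y ∈ closure (signCell (sphereFun f) (c v)))
    (hzx : z ∈ halfArc (c v) x) (hzy : z ∈ halfArc (c v) y) : x = y := by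
  obtain ⟨a, b, ha, hb, hz⟩ := hzx
  obtain ⟨a', b', ha', hb', hz'⟩ := hzy
  have heq := hz.symm.trans hz'
  have haa : a = a' := le_antisymm (h.coeff_le_of_combination_eq hyj hx hb.le heq.symm)
    (h.coeff_le_of_combination_eq hxi hy hb'.le heq)
  rw [haa] at heq
  have heq := add_left_cancel heq
  have hbb := eq_of_smul_eq_smul hb.le hb'.le heq
  rw [hbb] at heq
  exact Subtype.ext (smul_right_injective E3 hb'.ne' heq)

theorem apply_notMem_halfArc [Nonempty ι] (h : IsCellLabelling f G c)
    {x : UnitSphere} {u v : V} {i : ι} (hxi : sphereFun f i x = 0)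
    (hx : x ∈ closure (signCell (sphereFun f) (c v))) : c u ∉ halfArc (c v) x := fun hz => by
  rcases h.eq_or_mem_of_mem_halfArc hx hz with heq | hmem
  · exact h.ne_zero u i (by rw [heq, hxi])
  · obtain rfl := h.eq_of_mem u v hmem
    obtain ⟨a, b, ha, hb, hz⟩ := hz
    have h1 := congrArg (f i) hz
    have hxi : f i x = 0 := hxi
    rw [map_add, map_smul, map_smul, hxi, smul_zero, add_zero, smul_eq_mul] at h1
    -- If `c u` were on its own segment, `f i` would force coefficient one, leaving a positive
    -- multiple of `x` equal to zero.
    have ha1 : a = 1 := (mul_eq_right₀ (h.ne_zero u i)).1 h1.symm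
    rw [ha1, one_smul, left_eq_add] at hz
    exact (smul_ne_zero hb.ne' (unitSphere_ne_zero x)) hz

theorem exists_drawing [Nonempty ι] (h : IsCellLabelling f G c)
    (ψ : G.edgeSet ≃ signFacets (sphereFun f))
    (hψ : ∀ e : G.edgeSet, ∀ v ∈ (e : Sym2 V),
      (ψ e : Set UnitSphere) ⊆ closure (signCell (sphereFun f) (c v))) :
    ∃ D : GraphDrawing G UnitSphere, D.pos = c ∧
      ∀ e, ∃ x ∈ (ψ e : Set UnitSphere), D.arc e ∩ {y | ∃ i, sphereFun f i y = 0} = {x} := by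
  have hne : ∀ e, ∃ x, x ∈ (ψ e : Set UnitSphere) := fun e => by
    obtain ⟨i, x, hx, hxe⟩ := (ψ e).2
    exact ⟨x, by rw [hxe]; exact mem_signFacet_self hx⟩
  choose x hx using hne
  have hzero : ∀ e, ∃ i, sphereFun f i (x e) = 0 := fun e => by
    obtain ⟨i, y, hy, hye⟩ := (ψ e).2
    have := hx e
    rw [hye] at this
    exact ⟨i, this.1⟩
  have hinj : Function.Injective x := fun e e' hee => by
    obtain ⟨i, y, hy, hye⟩ := (ψ e).2
    obtain ⟨i', y', hy', hye'⟩ := (ψ e').2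
    have h1 := hx e
    have h2 := hx e'
    rw [hye] at h1
    rw [hye', ← hee] at h2
    exact ψ.injective (Subtype.ext (by rw [hye, hye', signFacet_eq_of_inter h1 h2]))
  -- Quantifying over the ends of the edge avoids choosing an orientation.
  let arc : G.edgeSet → Set UnitSphere := fun e =>
    {z | ∃ v ∈ (e : Sym2 V), z ∈ halfArc (c v) (x e)}
  refine ⟨⟨c, arc, ?_, ?_, ?_, ?_⟩, rfl, fun e => ⟨x e, hx e, ?_⟩⟩
  · exact fun u v huv => h.eq_of_mem u v (by rw [huv]; exact mem_signCell_self (h.ne_zero v))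
  · intro u v huv
    set e : G.edgeSet := ⟨s(u, v), huv⟩ with he
    have harc : arc e = halfArc (c u) (x e) ∪ halfArc (c v) (x e) := by
      ext z
      constructor
      · rintro ⟨w, hw, hz⟩
        rcases Sym2.mem_iff.1 hw with rfl | rfl
        exacts [Or.inl hz, Or.inr hz]
      · rintro (hz | hz)
        exacts [⟨u, Sym2.mem_mk_left _ _, hz⟩, ⟨v, Sym2.mem_mk_right _ _, hz⟩]
    rw [harc]
    obtain ⟨i, y, hy, hye⟩ := (ψ e).2
    have hxe := hx e
    have hu := hψ e u (Sym2.mem_mk_left _ _)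
    have hv := hψ e v (Sym2.mem_mk_right _ _)
    rw [hye] at hxe hu hv
    have hneg := h.mul_neg_of_incident hy (G.ne_of_adj huv) hu hv
    -- The separating form must be positive at the first end; otherwise its negative is used.
    rcases mul_neg_iff.1 hneg with hs | hs
    · exact isOpenArc_halfArc_union (φ := f i) hs.1 hxe.1 hs.2
    · have hx0 : f i (x e) = 0 := hxe.1
      exact isOpenArc_halfArc_union (φ := -f i) (neg_pos.2 hs.1) (by simp [hx0])
        (neg_neg_iff_pos.2 hs.2)
  · rintro u e ⟨v, hv, hz⟩
    obtain ⟨i, hi⟩ := hzero e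
    exact h.apply_notMem_halfArc hi (hψ e v hv (hx e)) hz
  · refine fun e e' hne => Set.disjoint_left.2 ?_
    rintro z ⟨v, hv, hz⟩ ⟨v', hv', hz'⟩
    obtain ⟨i, hi⟩ := hzero e
    obtain ⟨i', hi'⟩ := hzero e'
    have hcl := hψ e v hv (hx e)
    have hcl' := hψ e' v' hv' (hx e')
    rcases h.eq_or_mem_of_mem_halfArc hcl hz with hzx | hzv <;>
    rcases h.eq_or_mem_of_mem_halfArc hcl' hz' with hzx' | hzv'
    · exact hne (hinj (hzx.symm.trans hzx'))
    · rw [hzx] at hzv'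
      exact right_ne_zero_of_mul (hzv' i).ne' hi
    · rw [hzx'] at hzv
      exact right_ne_zero_of_mul (hzv i').ne' hi'
    · obtain rfl : v = v' := h.eq_of_mem v v' (by
        rw [← signCell_eq_of_mem hzv', signCell_eq_of_mem hzv]
        exact mem_signCell_self (h.ne_zero v))
      exact hne (hinj (h.eq_of_mem_halfArc_inter hi hi' hcl hcl' hz hz'))
  · ext z
    constructor
    · rintro ⟨⟨v, hv, hz⟩, i, hi⟩
      rcases h.eq_or_mem_of_mem_halfArc (hψ e v hv (hx e)) hz with hzx | hzv
      · exact hzx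
      · exact absurd hi (right_ne_zero_of_mul (hzv i).ne')
    · rintro rfl
      exact ⟨⟨_, Sym2.out_fst_mem _, 0, 1, le_rfl, one_pos, by simp⟩, hzero e⟩

theorem isPlanarDual [Finite ι] [Nonempty ι] (h : IsCellLabelling f G c) (hf : ∀ i, f i ≠ 0) :
    IsPlanarDual G (multipleZeros (sphereFun f)) (signFacets (sphereFun f))
      (fun v => signCell (sphereFun f) (c v)) := by
  have hunion := sUnion_facets_union_crossings (sphereFun f)
  have hfaces : embeddedFaces (multipleZeros (sphereFun f)) (signFacets (sphereFun f)) =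
      signCells (sphereFun f) := by
    rw [← arrangementCells_zeroSets (continuous_sphereFun f) isPreconnected_signCell_sphere,
      embeddedFaces, arrangementCells, hunion, show ⋃₀ zeroSets (sphereFun f) =
        {x | ∃ i, sphereFun f i x = 0} by ext; simp [zeroSets]]
  have hlabel : ∀ x, (∀ i, sphereFun f i x ≠ 0) →
      ∃ v, signCell (sphereFun f) x = signCell (sphereFun f) (c v) := fun x hx =>
    (h.exists_mem x hx).imp fun v hv => (signCell_eq_of_mem hv).symm
  have hinj : Function.Injective fun v => signCell (sphereFun f) (c v) := fun u v huv =>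
    h.eq_of_mem u v (by
      have huv : signCell (sphereFun f) (c u) = signCell (sphereFun f) (c v) := huv
      rw [← huv]; exact mem_signCell_self (h.ne_zero u))
  obtain ⟨ψ, hψ⟩ := h.exists_edge_equiv hf
  refine ⟨hinj, ?_, ψ, fun u v huv R hR => ?_, ?_⟩
  · rw [hfaces]
    ext R
    constructor
    · rintro ⟨v, rfl⟩
      exact ⟨c v, h.ne_zero v, rfl⟩
    · rintro ⟨x, hx, rfl⟩
      exact (hlabel x hx).imp fun v hv => hv.symm
  · have hu := hψ ⟨s(u, v), huv⟩ u (Sym2.mem_mk_left _ _)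
    have hv := hψ ⟨s(u, v), huv⟩ v (Sym2.mem_mk_right _ _)
    constructor
    · intro hsub
      rw [hfaces] at hR
      obtain ⟨x, hx, rfl⟩ := hR
      obtain ⟨w, hw⟩ := hlabel x hx
      rw [hw] at hsub ⊢
      exact (h.eq_or_eq_of_incident (ψ _).2 (G.ne_of_adj huv) hu hv hsub).imp
        (fun e => by rw [e]) (fun e => by rw [e])
    · rintro (rfl | rfl)
      exacts [hu, hv]
  · obtain ⟨D, hD, harc⟩ := h.exists_drawing ψ hψ
    refine ⟨D, fun v => ?_, fun e => ?_⟩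
    · rw [hD]; exact mem_signCell_self (h.ne_zero v)
    · rw [hunion]; exact harc e

end IsCellLabelling

end Duality

/-! ### Planar drawings from spherical drawings -/

/-- Stereographic projection from a point missed by the drawing is injective and continuous on all
of it. -/
theorem isPlanarGraph_of_drawing_sphere {V : Type*} {G : SimpleGraph V}
    (D : GraphDrawing G UnitSphere) (p : UnitSphere) (hpos : ∀ v, D.pos v ≠ p)
    (harc : ∀ e, p ∉ D.arc e) : IsPlanarGraph G := by
  have : Fact (Module.finrank ℝ E3 = 2 + 1) := ⟨by simp⟩
  let s := stereographic' 2 p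
  have hs : s.source = {p}ᶜ := stereographic'_source p
  have hinj : ∀ x y, x ≠ p → y ≠ p → s x = s y → x = y := fun x y hx hy =>
    s.injOn (by rw [hs]; exact hx) (by rw [hs]; exact hy)
  have harc' : ∀ e, ∀ z ∈ D.arc e, z ≠ p := fun e z hz h => harc e (h ▸ hz)
  refine ⟨⟨fun v => s (D.pos v), fun e => s '' D.arc e, ?_, ?_, ?_, ?_⟩⟩
  · exact fun u v huv => D.pos_injective (hinj _ _ (hpos u) (hpos v) huv)
  · intro u v huv
    obtain ⟨γ, hγc, hγi, hγ0, hγ1, hγ⟩ := D.isOpenArc u v huv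
    have hne : ∀ t, γ t ≠ p := fun t => by
      by_cases h0 : t = 0
      · rw [h0, hγ0]; exact hpos u
      by_cases h1 : t = 1
      · rw [h1, hγ1]; exact hpos v
      refine harc' ⟨s(u, v), huv⟩ _ ?_
      rw [hγ]
      exact ⟨t, ⟨unitInterval.pos_iff_ne_zero.2 h0, unitInterval.lt_one_iff_ne_one.2 h1⟩, rfl⟩
    refine ⟨s ∘ γ, ?_, ?_, ?_, ?_, ?_⟩
    · exact s.continuousOn.comp_continuous hγc fun t => by rw [hs]; exact hne t
    · exact fun t t' h => hγi (hinj _ _ (hne t) (hne t') h)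
    · rw [Function.comp_apply, hγ0]
    · rw [Function.comp_apply, hγ1]
    · rw [Set.image_comp, ← hγ]
  · rintro v e ⟨z, hz, h⟩
    exact D.pos_notMem_arc v e (hinj _ _ (harc' e z hz) (hpos v) h ▸ hz)
  · refine fun e e' hne => Set.disjoint_left.2 ?_
    rintro _ ⟨z, hz, rfl⟩ ⟨z', hz', h⟩
    exact Set.disjoint_left.1 (D.arc_disjoint e e' hne) hz
      (hinj _ _ (harc' e' z' hz') (harc' e z hz) h ▸ hz')

/-! ### Crossings of great circles -/

section Crossings

variable {ι : Type*} {f : ι → E3 →ₗ[ℝ] ℝ}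

theorem finrank_ker_inf_ker (hrank : ∀ i, Module.finrank ℝ (LinearMap.ker (f i)) = 2)
    (hker : Function.Injective fun i => LinearMap.ker (f i)) {i j : ι} (hij : i ≠ j) :
    Module.finrank ℝ ↥(LinearMap.ker (f i) ⊓ LinearMap.ker (f j)) = 1 := by
  have h1 := Submodule.finrank_sup_add_finrank_inf_eq (LinearMap.ker (f i)) (LinearMap.ker (f j))
  have h2 : Module.finrank ℝ ↥(LinearMap.ker (f i) ⊔ LinearMap.ker (f j)) ≤ 3 := by
    simpa using Submodule.finrank_le (LinearMap.ker (f i) ⊔ LinearMap.ker (f j))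
  have h3 : Module.finrank ℝ ↥(LinearMap.ker (f i) ⊓ LinearMap.ker (f j)) < 2 := by
    by_contra! hle
    have e1 := Submodule.eq_of_le_of_finrank_le
      (inf_le_left : LinearMap.ker (f i) ⊓ LinearMap.ker (f j) ≤ _) (by rw [hrank]; exact hle)
    have e2 := Submodule.eq_of_le_of_finrank_le
      (inf_le_right : LinearMap.ker (f i) ⊓ LinearMap.ker (f j) ≤ _) (by rw [hrank]; exact hle)
    exact hij (hker (e1.symm.trans e2))
  rw [hrank, hrank] at h1
  omega

theorem nonempty_multipleZeros [Nontrivial ι]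
    (hrank : ∀ i, Module.finrank ℝ (LinearMap.ker (f i)) = 2)
    (hker : Function.Injective fun i => LinearMap.ker (f i)) :
    (multipleZeros (sphereFun f)).Nonempty := by
  obtain ⟨i, j, hij⟩ := exists_pair_ne ι
  have h1 := finrank_ker_inf_ker hrank hker hij
  obtain ⟨v, hv, hv0⟩ := (Submodule.ne_bot_iff _).1 fun h : LinearMap.ker (f i) ⊓
    LinearMap.ker (f j) = ⊥ => by rw [h, finrank_bot] at h1; exact zero_ne_one h1
  exact ⟨radial v hv0, i, j, hij, sphereFun_radial_eq_zero_iff.2 hv.1,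
    sphereFun_radial_eq_zero_iff.2 hv.2⟩

theorem finite_multipleZeros [Finite ι]
    (hrank : ∀ i, Module.finrank ℝ (LinearMap.ker (f i)) = 2)
    (hker : Function.Injective fun i => LinearMap.ker (f i)) :
    (multipleZeros (sphereFun f)).Finite := by
  have : multipleZeros (sphereFun f) = ⋃ i, ⋃ j, ⋃ (_ : i ≠ j),
      {x | sphereFun f i x = 0 ∧ sphereFun f j x = 0} := by
    ext x; simp only [multipleZeros, Set.mem_iUnion, exists_prop]; rfl
  rw [this]
  refine Set.finite_iUnion fun i => Set.finite_iUnion fun j => Set.finite_iUnion fun hij => ?_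
  obtain ⟨⟨v, hv⟩, hv0, hspan⟩ := finrank_eq_one_iff'.1 (finrank_ker_inf_ker hrank hker hij)
  refine Set.Finite.of_finite_image (f := ((↑) : UnitSphere → E3)) ?_
    Subtype.val_injective.injOn
  -- Two distinct planes meet in a line, which has two antipodal unit vectors.
  refine (Set.toFinite {‖v‖⁻¹ • v, (-‖v‖⁻¹) • v}).subset ?_
  rintro _ ⟨x, hx, rfl⟩
  obtain ⟨t, ht⟩ := hspan ⟨x, hx⟩
  have ht : t • v = x := congrArg Subtype.val ht
  have hv0 : v ≠ 0 := fun h => hv0 (Subtype.ext h)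
  have hn : |t| * ‖v‖ = 1 := by
    have := congrArg norm ht
    rwa [norm_smul, norm_eq_of_mem_sphere] at this
  have hn' : |t| = ‖v‖⁻¹ := eq_inv_of_mul_eq_one_left hn
  rw [← ht, ← hn']
  rcases abs_choice t with h | h <;> rw [h]
  · exact Or.inl rfl
  · right; rw [neg_neg]; rfl

end Crossings

/-! ### The arrangements of a family of linear forms -/

section Forms

variable {ι : Type*} {f : ι → E3 →ₗ[ℝ] ℝ}

theorem injective_planeFun_zeros (hker : Function.Injective fun i => LinearMap.ker (f i)) :
    Function.Injective fun i => {x | planeFun f i x = 0} := fun _ _ hij =>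
  hker (SetLike.coe_injective hij)

theorem injective_sphereFun_zeros (hker : Function.Injective fun i => LinearMap.ker (f i)) :
    Function.Injective fun i => {x | sphereFun f i x = 0} := fun i j hij => by
  refine hker (Submodule.ext fun v => ?_)
  by_cases hv : v = 0
  · simp [hv]
  · exact sphereFun_radial_eq_zero_iff.symm.trans
      ((Set.ext_iff.1 hij (radial v hv)).trans sphereFun_radial_eq_zero_iff)

theorem arrangementCells_planeFun :
    arrangementCells (zeroSets (planeFun f)) = signCells (planeFun f) :=
  arrangementCells_zeroSets (continuous_planeFun f) fun x => (convex_signCell x).isPreconnected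

theorem arrangementFacets_planeFun (hker : Function.Injective fun i => LinearMap.ker (f i)) :
    arrangementFacets (zeroSets (planeFun f)) = signFacets (planeFun f) :=
  arrangementFacets_zeroSets (continuous_planeFun f) (injective_planeFun_zeros hker)
    fun i x => (convex_signFacet i x).isPreconnected

theorem arrangementFacets_sphereFun [Nontrivial ι]
    (hker : Function.Injective fun i => LinearMap.ker (f i)) :
    arrangementFacets (zeroSets (sphereFun f)) = signFacets (sphereFun f) :=
  arrangementFacets_zeroSets (continuous_sphereFun f) (injective_sphereFun_zeros hker)
    isPreconnected_signFacet_sphere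

theorem exists_base_points [Nonempty ι] :
    ∃ c : arrangementCells (zeroSets (planeFun f)) → UnitSphere,
      ∀ v, (∀ i, sphereFun f i (c v) ≠ 0) ∧ (v : Set E3) = signCell (planeFun f) (c v) := by
  have : ∀ v : arrangementCells (zeroSets (planeFun f)), ∃ c : UnitSphere,
      (∀ i, sphereFun f i c ≠ 0) ∧ (v : Set E3) = signCell (planeFun f) c := by
    rintro ⟨C, hC⟩
    rw [arrangementCells_planeFun] at hC
    obtain ⟨x, hx, rfl⟩ := hC
    have hx0 : x ≠ 0 := fun h => hx (Classical.arbitrary ι) (by simp [h, planeFun])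
    exact ⟨radial x hx0, fun i => by simpa [sphereFun_radial_eq_zero_iff] using hx i,
      (signCell_radial x hx0).symm⟩
  choose c hc using this
  exact ⟨c, hc⟩

/-- Incidence in space and on the sphere reduces to the same sign conditions, once the base point of
a spatial facet has been moved to the sphere. -/
theorem isCellLabelling_cellGraph [Nontrivial ι]
    (hker : Function.Injective fun i => LinearMap.ker (f i))
    {c : arrangementCells (zeroSets (planeFun f)) → UnitSphere}
    (hc : ∀ v, (∀ i, sphereFun f i (c v) ≠ 0) ∧ (v : Set E3) = signCell (planeFun f) (c v)) :
    IsCellLabelling f (cellGraph (zeroSets (planeFun f))) c where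
  ne_zero v := (hc v).1
  eq_of_mem u v huv := Subtype.ext <| by
    rw [(hc u).2, (hc v).2]
    exact signCell_eq_of_mem (g := planeFun f) huv
  exists_mem x hx := by
    let v : arrangementCells (zeroSets (planeFun f)) :=
      ⟨signCell (planeFun f) x, by rw [arrangementCells_planeFun]; exact ⟨x, hx, rfl⟩⟩
    refine ⟨v, ?_⟩
    have h1 : (c v : E3) ∈ signCell (planeFun f) (c v) := mem_signCell_self (hc v).1
    rw [← (hc v).2] at h1
    exact h1
  adj_iff u v := by
    have key : ∀ (w : arrangementCells (zeroSets (planeFun f))) {i : ι} {x : UnitSphere},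
        IsFacetPoint (sphereFun f) i x →
        (signFacet (planeFun f) i x ⊆ closure (w : Set E3) ↔
          signFacet (sphereFun f) i x ⊆ closure (signCell (sphereFun f) (c w))) :=
      fun w i x hx => by
        rw [(hc w).2, signFacet_subset_closure_iff hasClosedCells_planeFun (x := (x : E3)) hx
          (hc w).1, signFacet_subset_closure_iff hasClosedCells_sphereFun hx (hc w).1]
        rfl
    refine and_congr_right fun _ => ?_
    rw [arrangementFacets_planeFun hker]
    constructor
    · rintro ⟨_, ⟨i, x, hx, rfl⟩, hu, hv⟩
      -- A second form, nonzero at `x`, keeps `x` away from the origin.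
      obtain ⟨j, hj⟩ := exists_ne i
      have hx0 : x ≠ 0 := fun h => hx.2 j hj (by simp [h, planeFun])
      have hx' : IsFacetPoint (sphereFun f) i (radial x hx0) := isFacetPoint_radial_iff.2 hx
      have hmem : (radial x hx0 : E3) ∈ signFacet (planeFun f) i x :=
        ⟨hx'.1, fun k hk => mul_sphereFun_radial_pos_iff.2 (mul_self_pos.2 (hx.2 k hk))⟩
      rw [← signFacet_eq_of_mem hmem] at hu hv
      exact ⟨_, ⟨i, _, hx', rfl⟩, (key u hx').1 hu, (key v hx').1 hv⟩
    · rintro ⟨_, ⟨i, x, hx, rfl⟩, hu, hv⟩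
      exact ⟨_, ⟨i, x, hx, rfl⟩, (key u hx).2 hu, (key v hx).2 hv⟩

theorem isEmbeddedGraph_sphereFun [Finite ι] [Nontrivial ι]
    (hrank : ∀ i, Module.finrank ℝ (LinearMap.ker (f i)) = 2)
    (hker : Function.Injective fun i => LinearMap.ker (f i)) :
    IsEmbeddedGraph (multipleZeros (sphereFun f)) (signFacets (sphereFun f)) where
  finite_vertices := finite_multipleZeros hrank hker
  finite_edges := finite_signFacets _
  isOpenArc := by
    rintro _ ⟨i, x, hx, rfl⟩
    obtain ⟨p, q, hp, hq, h⟩ := isOpenArc_signFacet (hrank i) hx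
    exact ⟨p, hp, q, hq, h⟩
  vertex_notMem_edge := by
    rintro p ⟨i, j, hij, hi, hj⟩ _ ⟨k, x, -, rfl⟩ hp
    have hp' := IsFacetPoint.of_mem hp
    have h1 : i = k := by_contra fun h => hp'.2 i h hi
    have h2 : j = k := by_contra fun h => hp'.2 j h hj
    exact hij (h1.trans h2.symm)
  edge_disjoint := by
    rintro _ ⟨i, x, -, rfl⟩ _ ⟨j, y, -, rfl⟩ hne
    exact Set.disjoint_left.2 fun z hz hz' => hne (signFacet_eq_of_inter hz hz')

theorem planarity_of_linear_forms [Finite ι] [Nontrivial ι]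
    (hrank : ∀ i, Module.finrank ℝ (LinearMap.ker (f i)) = 2)
    (hker : Function.Injective fun i => LinearMap.ker (f i)) :
    IsPlanarGraph (cellGraph (zeroSets (planeFun f))) ∧
    IsEmbeddedGraph (arrangementCrossings (zeroSets (sphereFun f)))
      (arrangementFacets (zeroSets (sphereFun f))) ∧
    IsPlanarDual (cellGraph (zeroSets (planeFun f)))
      (arrangementCrossings (zeroSets (sphereFun f)))
      (arrangementFacets (zeroSets (sphereFun f)))
      (fun C => onSphere (C : Set E3)) := by
  have hf : ∀ i, f i ≠ 0 := fun i h => by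
    have := hrank i
    rw [h, LinearMap.ker_zero, finrank_top] at this
    simp at this
  obtain ⟨c, hc⟩ := exists_base_points (f := f)
  have hlab := isCellLabelling_cellGraph hker hc
  rw [arrangementCrossings_zeroSets (injective_sphereFun_zeros hker),
    arrangementFacets_sphereFun hker]
  refine ⟨?_, isEmbeddedGraph_sphereFun hrank hker, ?_⟩
  · obtain ⟨ψ, hψ⟩ := hlab.exists_edge_equiv hf
    obtain ⟨D, hD, harc⟩ := hlab.exists_drawing ψ hψ
    -- A crossing can serve as centre of projection: vertices are off all circles, and edges meet
    -- the circles only inside facets.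
    obtain ⟨p, hp⟩ := nonempty_multipleZeros hrank hker
    refine isPlanarGraph_of_drawing_sphere D p (fun v hv => ?_) fun e he => ?_
    · obtain ⟨i, -, -, hi, -⟩ := hp
      exact (hc v).1 i (by rw [← hD, hv]; exact hi)
    · obtain ⟨x, hx, hxe⟩ := harc e
      have hpx : p = x := by
        have : p ∈ D.arc e ∩ {y | ∃ i, sphereFun f i y = 0} := ⟨he, hp.imp fun i ⟨_, _, hi, _⟩ => hi⟩
        rw [hxe] at this
        exact this
      exact (isEmbeddedGraph_sphereFun hrank hker).vertex_notMem_edge p hp _ (ψ e).2 (hpx ▸ hx)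
  · have : (fun C : arrangementCells (zeroSets (planeFun f)) => onSphere (C : Set E3)) =
        fun v => signCell (sphereFun f) (c v) := by
      funext v
      rw [(hc v).2]
      rfl
    rw [this]
    exact hlab.isPlanarDual hf

end Forms

/-! ### Arrangements of lines in the projective plane -/

section Lines

variable {A : Finset (Projectivization.Subspace ℝ E3)}

theorem exists_linear_form {ℓ : Projectivization.Subspace ℝ E3} (hℓ : IsProjectiveLine ℓ) :
    ∃ φ : E3 →ₗ[ℝ] ℝ, LinearMap.ker φ = Projectivization.Subspace.submodule ℓ := by
  have hℓ : Module.finrank ℝ (Projectivization.Subspace.submodule ℓ) = 2 := hℓ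
  obtain ⟨φ, hφ, hle⟩ := (Projectivization.Subspace.submodule ℓ).exists_le_ker_of_lt_top
    (lt_top_iff_ne_top.2 fun h => by rw [h, finrank_top] at hℓ; simp at hℓ)
  refine ⟨φ, (Submodule.eq_of_le_of_finrank_le hle ?_).symm⟩
  have : Module.finrank ℝ (LinearMap.ker φ) < Module.finrank ℝ E3 :=
    Submodule.finrank_lt fun h => hφ (LinearMap.ker_eq_top.1 h)
  simp only [finrank_euclideanSpace, Fintype.card_fin] at this
  omega

theorem isPreconnected_affinePlane (φ : E3 →ₗ[ℝ] ℝ) :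
    IsPreconnected {p : ℙ ℝ E3 | ∃ (v : E3) (hv : v ≠ 0), 0 < φ v ∧
      p = Projectivization.mk ℝ v hv} := by
  have hne : ∀ v : {v : E3 | 0 < φ v}, (v : E3) ≠ 0 := fun v h => by
    have := v.2
    rw [h] at this
    simp at this
  have hcont : Continuous fun v : {v : E3 | 0 < φ v} => Projectivization.mk ℝ (v : E3) (hne v) :=
    (continuous_quotient_mk' (s := projectivizationSetoid ℝ E3)).comp
      (continuous_subtype_val.subtype_mk hne)
  have := isPreconnected_iff_preconnectedSpace.1
    (convex_halfSpace_gt φ.isLinear 0).isPreconnected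
  convert isPreconnected_range hcont using 1
  ext p
  constructor
  · rintro ⟨v, hv, h, rfl⟩
    exact ⟨⟨v, h⟩, rfl⟩
  · rintro ⟨v, rfl⟩
    exact ⟨v, hne v, v.2, rfl⟩

/-- A vector with coordinates of both signs represents no point of the triangle, and neither does
its negative, so `φ` vanishes on it. The vectors `b i - s • b j` with `s = 1` and `s = 2` then force
`φ = 0`. -/
theorem not_isProjectiveTriangle_of_affinePlane {φ : E3 →ₗ[ℝ] ℝ} (hφ : φ ≠ 0)
    {T : Set (ℙ ℝ E3)}
    (hT : ∀ (v : E3) (hv : v ≠ 0), 0 < φ v → Projectivization.mk ℝ v hv ∈ T) :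
    ¬ IsProjectiveTriangle T := by
  rintro ⟨b, rfl⟩
  have key : ∀ (v : E3) (i j : Fin 3), 0 < b.repr v i → b.repr v j < 0 → φ v = 0 := by
    have hpos : ∀ (v : E3) (i j : Fin 3), 0 < b.repr v i → b.repr v j < 0 → ¬ 0 < φ v := by
      intro v i j hi hj hv
      have hv0 : v ≠ 0 := fun h => by simp [h] at hv
      obtain ⟨w, hw, hwpos, hvw⟩ := hT v hv0 hv
      obtain ⟨a, ha⟩ := (Projectivization.mk_eq_mk_iff' ℝ v w hv0 hw).1 hvw
      rw [← ha, map_smul, Finsupp.smul_apply, smul_eq_mul] at hi hj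
      have := mul_pos_iff_of_pos_right (hwpos i) |>.1 hi
      exact hj.not_gt (mul_pos this (hwpos j))
    intro v i j hi hj
    refine le_antisymm (not_lt.1 (hpos v i j hi hj)) (not_lt.1 fun h => ?_)
    refine hpos (-v) j i (by simpa using hj) (by simpa using hi) (by simpa using h)
  have hdiff : ∀ i j, i ≠ j → ∀ s : ℝ, 0 < s → φ (b i) = s * φ (b j) := fun i j hij s hs => by
    have := key (b i - s • b j) i j (by simp [hij.symm]) (by simp [hij, hs])
    rw [map_sub, map_smul, smul_eq_mul] at this
    linarith
  refine hφ (b.ext fun i => ?_)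
  obtain ⟨j, hj⟩ := exists_ne i
  have h1 := hdiff i j hj.symm 1 one_pos
  have h2 := hdiff i j hj.symm 2 two_pos
  rw [LinearMap.zero_apply]
  linarith

theorem IsSimplicialLineArrangement.nontrivial (hA : IsSimplicialLineArrangement A) :
    Nontrivial A := by
  by_contra hnt
  rw [not_nontrivial_iff_subsingleton] at hnt
  -- With at most one line, a single nonzero form covers the arrangement; for the empty one any form
  -- will do.
  obtain ⟨φ, hφ0, hφ⟩ : ∃ φ : E3 →ₗ[ℝ] ℝ, φ ≠ 0 ∧
      ∀ ℓ ∈ A, Projectivization.Subspace.submodule ℓ = LinearMap.ker φ := by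
    rcases A.eq_empty_or_nonempty with rfl | ⟨ℓ, hℓ⟩
    · obtain ⟨φ, hφ⟩ := exists_ne (0 : E3 →ₗ[ℝ] ℝ)
      exact ⟨φ, hφ, by simp⟩
    · obtain ⟨φ, hφ⟩ := exists_linear_form (hA.isLine ℓ hℓ)
      refine ⟨φ, ?_, fun ℓ' hℓ' => ?_⟩
      · rintro rfl
        have h2 : Module.finrank ℝ (Projectivization.Subspace.submodule ℓ) = 2 := hA.isLine ℓ hℓ
        rw [← hφ, LinearMap.ker_zero, finrank_top] at h2
        simp at h2
      · rw [hφ, show ℓ' = ℓ from congrArg Subtype.val (Subsingleton.elim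
          (⟨ℓ', hℓ'⟩ : A) ⟨ℓ, hℓ⟩)]
  have hcompl : {p : ℙ ℝ E3 | ∃ (v : E3) (hv : v ≠ 0), 0 < φ v ∧
      p = Projectivization.mk ℝ v hv} ⊆ (⋃₀ lineSets A)ᶜ := by
    rintro _ ⟨v, hv, hpos, rfl⟩ ⟨_, ⟨ℓ, hℓ, rfl⟩, hmem⟩
    have h1 := (Projectivization.Subspace.mem_submodule_iff ℓ hv).2 hmem
    rw [hφ ℓ hℓ] at h1
    exact hpos.ne' h1
  obtain ⟨u, hu⟩ : ∃ u, 0 < φ u := by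
    obtain ⟨u, hu⟩ := DFunLike.ne_iff.1 hφ0
    rcases lt_or_gt_of_ne hu with h | h
    · exact ⟨-u, by simpa using h⟩
    · exact ⟨u, h⟩
  have hu0 : u ≠ 0 := fun h => by simp [h] at hu
  refine not_isProjectiveTriangle_of_affinePlane hφ0
    (T := connectedComponentIn (⋃₀ lineSets A)ᶜ (Projectivization.mk ℝ u hu0))
    (fun v hv hpos => ?_) (hA.isTriangle _ ⟨_, hcompl ⟨u, hu0, hu, rfl⟩, rfl⟩)
  exact (isPreconnected_affinePlane φ).subset_connectedComponentIn ⟨u, hu0, hu, rfl⟩ hcompl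
    ⟨v, hv, hpos, rfl⟩

end Lines

theorem theorem2 (A : Finset (Projectivization.Subspace ℝ E3))
    (hA : IsSimplicialLineArrangement A) :
    IsPlanarGraph (arrangementGraph A) ∧
    IsEmbeddedGraph (arrangementCrossings (greatCircles A))
      (arrangementFacets (greatCircles A)) ∧
    IsPlanarDual (arrangementGraph A)
      (arrangementCrossings (greatCircles A)) (arrangementFacets (greatCircles A))
      (fun C => onSphere (C : Set E3)) := by
  -- The only place where the triangular shape of the cells enters.
  have := hA.nontrivial
  choose f hf using fun ℓ : A => exists_linear_form (hA.isLine ℓ ℓ.2)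
  have hplanes : liftedPlanes A = zeroSets (planeFun f) := by
    have hcoe : ∀ ℓ : A, {x | planeFun f ℓ x = 0} =
        (Projectivization.Subspace.submodule (ℓ : Projectivization.Subspace ℝ E3) : Set E3) :=
      fun ℓ => by rw [← hf ℓ]; rfl
    ext H
    constructor
    · rintro ⟨ℓ, hℓ, rfl⟩
      exact ⟨⟨ℓ, hℓ⟩, hcoe _⟩
    · rintro ⟨ℓ, rfl⟩
      exact ⟨ℓ, ℓ.2, hcoe ℓ⟩
  have hcircles : greatCircles A = zeroSets (sphereFun f) := by
    rw [greatCircles, hplanes, zeroSets, ← Set.range_comp]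
    rfl
  have hrank : ∀ ℓ, Module.finrank ℝ (LinearMap.ker (f ℓ)) = 2 := fun ℓ => by
    rw [hf ℓ]; exact hA.isLine ℓ ℓ.2
  have hker : Function.Injective fun ℓ => LinearMap.ker (f ℓ) := fun ℓ ℓ' h => by
    simp only [hf] at h
    exact Subtype.ext (Projectivization.Subspace.submodule.injective h)
  rw [hcircles]
  unfold arrangementGraph
  rw [hplanes]
  exact planarity_of_linear_forms hrank hker

end
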